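/- Let $q>2$ be a prime power, let $n\in\{-1,0,1\}$ with $q\equiv n\pmod 3$, and let $g=\gcd(3,q-1)$. Let $V$ be a 3-dimensional vector space over $\mathbb{F}_{q^3}$, so that $V$ gives $\mathrm{PG}(2,q^3)$ and, regarded as a 9-dimensional space over $\mathbb{F}_q$, gives $\mathrm{PG}(8,q)$. A point $\bar P$ of $\mathrm{PG}(2,q^3)$ is a 3-dimensional $\mathbb{F}_q$-subspace of $V$, that is, a plane $[\![P]\!]$ of $\mathrm{PG}(8,q)$, called an $\mathbb{S}$-plane; a line of $\mathrm{PG}(2,q^3)$ is likewise a 5-space of $\mathrm{PG}(8,q)$, called an $\mathbb{H}$-5-space. The $\mathbb{S}$-planes form a regular 2-spread of $\mathrm{PG}(8,q)$. Let $\phi$ be a collineation of $\mathrm{PG}(2,q^3)$ of order 3 which fixes pointwise an $\mathbb{F}_q$-plane (the set of points with coordinates in $\mathbb{F}_q$ with respect to some basis of $V$). Let $\sigma\in\mathrm{PGL}(9,q)$ be a projectivity of $\mathrm{PG}(8,q)$ that induces $\phi$, that is, $[\![P]\!]^\sigma=[\![\phi(P)]\!]$ for every point $\bar P$ of $\mathrm{PG}(2,q^3)$.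 A point of $\mathrm{PG}(2,q^3)$ has Type I if it is fixed by $\phi$, and Type II if its $\phi$-orbit consists of three distinct collinear points; a line of $\mathrm{PG}(2,q^3)$ has Type I if it is fixed by $\phi$. The corresponding $\mathbb{S}$-planes and $\mathbb{H}$-5-spaces are given the same type. A I-point (II-point) is a point of $\mathrm{PG}(8,q)$ lying in an $\mathbb{S}$-plane of Type I (Type II). A fixed point is a point $A$ of $\mathrm{PG}(8,q)$ with $A^\sigma=A$; a $\mathrm{I}_{:}$-point is a I-point $A$ such that $A,A^\sigma,A^{\sigma^2}$ are distinct and collinear; a $\mathrm{II}_{:}$-point is a II-point $A$ such that $A,A^\sigma,A^{\sigma^2}$ are collinear. A ptwise-fixed line (plane) is a line (plane) of $\mathrm{PG}(8,q)$ all of whose points are fixed. A fixed-I-line is a line of $\mathrm{PG}(8,q)$ fixed by $\sigma$ which contains exactly $n+1$ fixed points and $q-n$ $\mathrm{I}_{:}$-points and is contained in an $\mathbb{S}$-plane of Type I. A fixed-II-line is a line fixed by $\sigma$ which contains exactly $n+1$ fixed points and $q-n$ $\mathrm{II}_{:}$-points, meets exactly $n+1$ $\mathbb{S}$-planes of Type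 I and $q-n$ $\mathbb{S}$-planes of Type II, and is contained in a unique $\mathbb{H}$-5-space, which has Type I. Let $\Pi$ be a 5-space of $\mathrm{PG}(8,q)$ that is fixed hyperplane-wise by $\sigma$, that is, every hyperplane (7-space) containing $\Pi$ is fixed by $\sigma$. Then $\Pi$ contains exactly * $(n+1)(q^2+q+1)$ fixed points, $(q-n)(q^2+q+1)$ $\mathrm{I}_{:}$-points and $(q^3-q)(q^2+q+1)$ $\mathrm{II}_{:}$-points; * $(n+1)(q^2+q+1)$ ptwise-fixed lines, $q^2+q+1$ fixed-I-lines and $(q^3-q)(q^2+q+1)/(q-n)$ fixed-II-lines; * $n+1$ ptwise-fixed planes; and there are exactly $g-(n+1)$ further ptwise-fixed planes in $\mathrm{PG}(8,q)$, each of which is disjoint from $\Pi$. -/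

import Mathlib

open scoped LinearAlgebra.Projectivization

namespace BoseRep

section General

variable {F W : Type*} [Field F] [AddCommGroup W] [Module F W]

/-- `U` is a projective subspace of (projective) dimension `d` of `PG(W)`:
a vector subspace of rank `d + 1`. -/
def IsSubspaceOfDim (d : ℕ) (U : Submodule F W) : Prop :=
  Module.finrank F U = d + 1

/-- The point `P` lies on the projective subspace `U`. -/
def On (P : ℙ F W) (U : Submodule F W) : Prop :=
  P.submodule ≤ U

/-- Three points lie on a common line. -/
def Collinear (P Q R : ℙ F W) : Prop :=
  ∃ l : Submodule F W, IsSubspaceOfDim 1 l ∧ On P l ∧ On Q l ∧ On R l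

/-- A collineation: a permutation of the points that preserves collinearity in both directions. -/
def IsCollineation (φ : Equiv.Perm (ℙ F W)) : Prop :=
  ∀ P Q R, Collinear P Q R ↔ Collinear (φ P) (φ Q) (φ R)

/-- The action on points of the projectivity with linear representative `σ`. -/
def act (σ : W ≃ₗ[F] W) (P : ℙ F W) : ℙ F W :=
  Projectivization.map (σ : W →ₗ[F] W) σ.injective P

/-- The subspace `U` is fixed (as a set) by the projectivity represented by `σ`. -/
def IsFixedSubspace (σ : W ≃ₗ[F] W) (U : Submodule F W) : Prop :=
  U.map (σ : W →ₗ[F] W) = U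

/-- Every point of `U` is fixed by the projectivity represented by `σ`. -/
def IsPtwiseFixed (σ : W ≃ₗ[F] W) (U : Submodule F W) : Prop :=
  ∀ A : ℙ F W, On A U → act σ A = A

end General

section FieldReduction

variable {K L V : Type*} [Field K] [Field L] [Algebra K L] [AddCommGroup V]
  [Module K V] [Module L V] [IsScalarTower K L V]

variable (K) in
/-- A `K`-subplane of `PG(V)`, `V` of rank 3 over `L`: the points having coordinates in `K`
with respect to some `L`-basis of `V`. -/
def IsSubplane (B : Set (ℙ L V)) : Prop :=
  ∃ b : Module.Basis (Fin 3) L V,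
    B = {P | ∃ a : Fin 3 → K, ∃ h : (∑ i, a i • b i) ≠ 0, P = Projectivization.mk L (∑ i, a i • b i) h}

variable (K) in
/-- The spread element of `PG(8, q)` corresponding to a point of `PG(2, q³)`. -/
def sPlane (P : ℙ L V) : Submodule K V :=
  P.submodule.restrictScalars K

variable (K) in
/-- The 5-space of `PG(8, q)` corresponding to a line `m` of `PG(2, q³)`. -/
def hSpace (m : Submodule L V) : Submodule K V :=
  m.restrictScalars K

/-- The projectivity of `PG(8, q)` represented by `σ` induces `φ` on the spread elements. -/
def Induces (σ : V ≃ₗ[K] V) (φ : Equiv.Perm (ℙ L V)) : Prop :=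
  ∀ P : ℙ L V, (sPlane K P).map (σ : V →ₗ[K] V) = sPlane K (φ P)

/-- Type I: the orbit under `φ` is one point. -/
def IsTypeI (φ : Equiv.Perm (ℙ L V)) (P : ℙ L V) : Prop :=
  φ P = P

/-- Type II: the orbit under `φ` (of order 3) consists of three collinear points. -/
def IsTypeII (φ : Equiv.Perm (ℙ L V)) (P : ℙ L V) : Prop :=
  P ≠ φ P ∧ φ P ≠ φ (φ P) ∧ P ≠ φ (φ P) ∧ Collinear P (φ P) (φ (φ P))

/-- A line of `PG(2, q³)` whose orbit under `φ` is one line. -/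
def IsTypeILine (φ : Equiv.Perm (ℙ L V)) (m : Submodule L V) : Prop :=
  IsSubspaceOfDim 1 m ∧ ∀ P : ℙ L V, On P m ↔ On (φ P) m

/-- A point of `PG(8, q)` in a spread element of Type I. -/
def IsIPoint (φ : Equiv.Perm (ℙ L V)) (A : ℙ K V) : Prop :=
  ∃ P : ℙ L V, IsTypeI φ P ∧ On A (sPlane K P)

/-- A point of `PG(8, q)` in a spread element of Type II. -/
def IsIIPoint (φ : Equiv.Perm (ℙ L V)) (A : ℙ K V) : Prop :=
  ∃ P : ℙ L V, IsTypeII φ P ∧ On A (sPlane K P)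

/-- A `I:`-point: a I-point with three distinct collinear points in its orbit. -/
def IsIColonPoint (φ : Equiv.Perm (ℙ L V)) (σ : V ≃ₗ[K] V) (A : ℙ K V) : Prop :=
  IsIPoint φ A ∧ A ≠ act σ A ∧ act σ A ≠ act σ (act σ A) ∧ A ≠ act σ (act σ A) ∧
    Collinear A (act σ A) (act σ (act σ A))

/-- A `II:`-point: a II-point with collinear orbit. -/
def IsIIColonPoint (φ : Equiv.Perm (ℙ L V)) (σ : V ≃ₗ[K] V) (A : ℙ K V) : Prop :=
  IsIIPoint φ A ∧ Collinear A (act σ A) (act σ (act σ A))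

/-- A line of `PG(8, q)` that is fixed pointwise. -/
def IsPtwiseFixedLine (σ : V ≃ₗ[K] V) (l : Submodule K V) : Prop :=
  IsSubspaceOfDim 1 l ∧ IsPtwiseFixed σ l

/-- A plane of `PG(8, q)` that is fixed pointwise. -/
def IsPtwiseFixedPlane (σ : V ≃ₗ[K] V) (U : Submodule K V) : Prop :=
  IsSubspaceOfDim 2 U ∧ IsPtwiseFixed σ U

/-- A fixed-I-line: a fixed line with exactly `n + 1` fixed points and `q - n` `I:`-points,
contained in a spread element of Type I. -/
def IsFixedILine (φ : Equiv.Perm (ℙ L V)) (σ : V ≃ₗ[K] V) (n : ℤ) (l : Submodule K V) : Prop :=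
  IsSubspaceOfDim 1 l ∧ IsFixedSubspace σ l ∧
  ({A : ℙ K V | On A l ∧ act σ A = A}.ncard : ℤ) = n + 1 ∧
  ({A : ℙ K V | On A l ∧ IsIColonPoint φ σ A}.ncard : ℤ) = Nat.card K - n ∧
  ∃ P : ℙ L V, IsTypeI φ P ∧ l ≤ sPlane K P

/-- A fixed-II-line: a fixed line with exactly `n + 1` fixed points and `q - n` `II:`-points,
meeting `n + 1` spread elements of Type I and `q - n` spread elements of Type II, and contained
in a unique 5-space corresponding to a line of `PG(2, q³)`, which has Type I. -/
def IsFixedIILine (φ : Equiv.Perm (ℙ L V)) (σ : V ≃ₗ[K] V) (n : ℤ) (l : Submodule K V) : Prop :=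
  IsSubspaceOfDim 1 l ∧ IsFixedSubspace σ l ∧
  ({A : ℙ K V | On A l ∧ act σ A = A}.ncard : ℤ) = n + 1 ∧
  ({A : ℙ K V | On A l ∧ IsIIColonPoint φ σ A}.ncard : ℤ) = Nat.card K - n ∧
  ({P : ℙ L V | IsTypeI φ P ∧ ¬ Disjoint l (sPlane K P)}.ncard : ℤ) = n + 1 ∧
  ({P : ℙ L V | IsTypeII φ P ∧ ¬ Disjoint l (sPlane K P)}.ncard : ℤ) = Nat.card K - n ∧
  ∃ m : Submodule L V, IsTypeILine φ m ∧ l ≤ hSpace K m ∧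
    ∀ m' : Submodule L V, IsSubspaceOfDim 1 m' → l ≤ hSpace K m' → m' = m

/-- A 5-space of `PG(8, q)` fixed hyperplane-wise: every hyperplane (7-space) through it is
fixed. -/
def IsHwiseFixed5Space (σ : V ≃ₗ[K] V) (U : Submodule K V) : Prop :=
  IsSubspaceOfDim 5 U ∧
    ∀ H : Submodule K V, IsSubspaceOfDim 7 H → U ≤ H → IsFixedSubspace σ H

end FieldReduction

end BoseRep

set_option linter.unusedSectionVars false

namespace BoseRep

/-! ### Points, lines and scalar actions in a projective space -/

section General

variable {F W : Type*} [Field F] [AddCommGroup W] [Module F W]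

/-! Since `φ` fixes a subplane pointwise and `σ` is `K`-linear and permutes the spread, `σ` acts on
coordinates as a field automorphism `f` of `L` over `K` followed by multiplication by some `d` in
`L` (`Induces.exists_algEquiv`); `f ≠ 1` because `φ ≠ 1`. The hyperplanes through `U` being fixed
means that `σ` is a scalar `c` in `K` modulo `U`. As `σ - c` maps into `U`, it has a kernel, and a
nonzero coordinate of a kernel vector rescales the basis so that `σ = c τ`, where `τ` merely applies
`f` to the coordinates. Thus `τ³ = 1`, and `U`, being the image of `τ - 1`, is the kernel of `1 + τ
+ τ²` (`exists_isCoordinateFrobenius`, `eq_normKer`).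

Everything is now counted in this kernel. An eigenvector of `τ` lies in it exactly when its
eigenvalue is a root of `X² + X + 1`; there are `n + 1` roots in `K`, and by Hilbert 90 each
eigenspace has rank 3, like the fixed space. This gives the fixed points, the pointwise fixed lines
and the planes. The only other cube root of unity is 1, when the characteristic is not 3, and it
gives the one plane off `U`.

A spread element of Type I is `L v` with `τ v = v`, and it meets `U` in the multiples of `v` by
elements of trace zero: a line, which is the fixed-I-line. These disjoint lines carry all I-points
of `U`. For any other vector `v` of `U`, the relation `v + τ v + τ² v = 0` makes both the orbit of
the point and the orbit of its spread element collinear, so the point is a `II:`-point, and its only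
fixed-II-line is spanned by `v` and `τ v`. These lines therefore partition the II-points of `U` into
classes of size `q - n`. -/

theorem on_mk {v : W} {hv : v ≠ 0} {U : Submodule F W} :
    On (Projectivization.mk F v hv) U ↔ v ∈ U := by
  simp [On, Projectivization.submodule_mk]

theorem act_mk (σ : W ≃ₗ[F] W) {v : W} (hv : v ≠ 0) :
    act σ (Projectivization.mk F v hv) =
      Projectivization.mk F (σ v) (σ.map_ne_zero_iff.2 hv) := rfl

theorem act_mk_eq_self_iff (σ : W ≃ₗ[F] W) {v : W} (hv : v ≠ 0) :
    act σ (Projectivization.mk F v hv) = Projectivization.mk F v hv ↔ ∃ μ : F, σ v = μ • v := by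
  rw [act_mk, Projectivization.mk_eq_mk_iff']
  exact exists_congr fun _ => eq_comm

theorem On.mono {A : ℙ F W} {U U' : Submodule F W} (h : On A U) (hU : U ≤ U') : On A U' :=
  le_trans h hU

theorem on_inf {A : ℙ F W} {U U' : Submodule F W} : On A (U ⊓ U') ↔ On A U ∧ On A U' :=
  le_inf_iff

theorem exists_on_of_not_disjoint {U U' : Submodule F W} (h : ¬ Disjoint U U') :
    ∃ A : ℙ F W, On A U ∧ On A U' := by
  rw [Submodule.disjoint_def] at h
  push Not at h
  obtain ⟨v, h1, h2, hv⟩ := h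
  exact ⟨Projectivization.mk F v hv, on_mk.2 h1, on_mk.2 h2⟩

theorem not_disjoint_of_on {A : ℙ F W} {U U' : Submodule F W} (h : On A U) (h' : On A U') :
    ¬ Disjoint U U' := by
  induction A using Projectivization.ind with
  | h v hv =>
    intro hd
    exact hv (Submodule.disjoint_def.1 hd v (on_mk.1 h) (on_mk.1 h'))

/-- The points of a subspace are the points of the projective space it carries. -/
theorem ncard_setOf_on [Finite F] (U : Submodule F W) {d : ℕ} (h : Module.finrank F U = d) :
    {A : ℙ F W | On A U}.ncard = ∑ i ∈ Finset.range d, Nat.card F ^ i := by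
  rw [← Projectivization.card_of_finrank F U h, ← Nat.card_coe_set_eq]
  symm
  refine Nat.card_congr (Equiv.ofBijective (fun A : ℙ F U =>
    (⟨Projectivization.map U.subtype U.injective_subtype A, ?_⟩ : {A : ℙ F W | On A U}))
    ⟨?_, ?_⟩)
  · induction A using Projectivization.ind with
    | h v hv => exact on_mk.2 v.2
  · intro A B hAB
    exact Projectivization.map_injective U.subtype U.injective_subtype (congrArg Subtype.val hAB)
  · rintro ⟨A, hA⟩
    induction A using Projectivization.ind with
    | h v hv =>
      refine ⟨Projectivization.mk F ⟨v, on_mk.1 hA⟩ (by simpa using hv), ?_⟩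
      rfl

/-- By duality: the lines of a plane are the points of the dual plane, through annihilators. -/
theorem ncard_setOf_finrank_eq_two [Finite F] [FiniteDimensional F W]
    (h : Module.finrank F W = 3) :
    {l : Submodule F W | Module.finrank F l = 2}.ncard =
      Nat.card F ^ 2 + Nat.card F + 1 := by
  have hd : Module.finrank F (Module.Dual F W) = 3 := by
    rw [Subspace.dual_finrank_eq, h]
  have hc := Projectivization.card_of_finrank F (Module.Dual F W) hd
  rw [← Nat.card_coe_set_eq]
  trans Nat.card (ℙ F (Module.Dual F W))
  · refine Nat.card_congr (Equiv.trans ?_ (Projectivization.equivSubmodule F _).symm)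
    refine ((Subspace.orderIsoFiniteDimensional (K := F) (V := W)).toEquiv.trans
      OrderDual.ofDual).subtypeEquiv fun l => ?_
    have := Subspace.finrank_add_finrank_dualAnnihilator_eq l
    change Module.finrank F l = 2 ↔ Module.finrank F l.dualAnnihilator = 1
    omega
  · rw [hc]
    simp [Finset.sum_range_succ]
    ring

theorem ncard_setOf_le_finrank_eq_two [Finite F] [FiniteDimensional F W]
    (U : Submodule F W) (h : Module.finrank F U = 3) :
    {l : Submodule F W | l ≤ U ∧ Module.finrank F l = 2}.ncard =
      Nat.card F ^ 2 + Nat.card F + 1 := by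
  rw [← ncard_setOf_finrank_eq_two h]
  symm
  refine Set.ncard_congr (fun l _ => l.map U.subtype) ?_ ?_ ?_
  · intro l hl
    refine ⟨Submodule.map_subtype_le _ _, ?_⟩
    exact (Submodule.equivMapOfInjective _ U.injective_subtype l).finrank_eq.symm.trans hl
  · intro l l' _ _ hl
    exact Submodule.map_injective_of_injective U.injective_subtype hl
  · rintro l ⟨hl, h2⟩
    refine ⟨l.comap U.subtype, ?_, ?_⟩
    · rw [Set.mem_ofPred_eq, ← h2]
      exact (Submodule.comapSubtypeEquivOfLe hl).finrank_eq
    · rw [Submodule.map_comap_subtype, inf_eq_right.2 hl]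

/-- A linear map of which every nonzero vector of `U` is an eigenvector is a scalar on `U`. -/
theorem exists_scalar_of_forall_exists (T : W →ₗ[F] W) (U : Submodule F W)
    (h : ∀ v ∈ U, ∃ μ : F, T v = μ • v) : ∃ μ : F, ∀ v ∈ U, T v = μ • v := by
  have hmap : ∀ v ∈ U, T v ∈ U := by
    intro v hv
    obtain ⟨μ, hμ⟩ := h v hv
    rw [hμ]
    exact U.smul_mem _ hv
  obtain ⟨μ, hμ⟩ := LinearMap.exists_eq_smul_id_of_forall_notLinearIndependent
    (f := T.restrict hmap) (by
      intro v hli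
      obtain ⟨μ, hμ⟩ := h v v.2
      rw [LinearIndependent.pair_iff] at hli
      have := (hli μ (-1) (by ext; simp [hμ])).2
      simp at this)
  refine ⟨μ, fun v hv => ?_⟩
  have := congrArg Subtype.val (LinearMap.congr_fun hμ ⟨v, hv⟩)
  simpa using this

theorem isPtwiseFixed_iff (σ : W ≃ₗ[F] W) (U : Submodule F W) :
    IsPtwiseFixed σ U ↔ ∃ μ : F, ∀ v ∈ U, σ v = μ • v := by
  constructor
  · intro h
    refine exists_scalar_of_forall_exists (σ : W →ₗ[F] W) U fun v hv => ?_
    by_cases h0 : v = 0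
    · exact ⟨0, by simp [h0]⟩
    · exact (act_mk_eq_self_iff σ h0).1 (h _ (on_mk.2 hv))
  · rintro ⟨μ, hμ⟩ A hA
    induction A using Projectivization.ind with
    | h v hv => exact (act_mk_eq_self_iff σ hv).2 ⟨μ, hμ v (on_mk.1 hA)⟩

theorem finrank_span_pair_eq_two {v w : W} (hv : v ≠ 0) (h : ∀ a : F, a • v ≠ w) :
    Module.finrank F (Submodule.span F {v, w}) = 2 := by
  have hli : LinearIndependent F ![v, w] :=
    (LinearIndependent.pair_iff' hv).2 h
  have := finrank_span_eq_card hli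
  rwa [Matrix.range_cons_cons_empty, Fintype.card_fin] at this

theorem eq_span_pair {l : Submodule F W} (hl : Module.finrank F l = 2) {v w : W} (hv : v ≠ 0)
    (h : ∀ a : F, a • v ≠ w) (hvl : v ∈ l) (hwl : w ∈ l) : Submodule.span F {v, w} = l := by
  have : FiniteDimensional F l := Module.finite_of_finrank_pos (by omega)
  refine Submodule.eq_of_le_of_finrank_eq ?_ ?_
  · rw [Submodule.span_le]
    rintro x (rfl | rfl) <;> assumption
  · rw [finrank_span_pair_eq_two hv h, hl]

theorem eq_of_on_of_on {l m : Submodule F W} (hl : Module.finrank F l = 2)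
    {A B : ℙ F W} (hAB : A ≠ B) (hAl : On A l) (hBl : On B l) (hAm : On A m) (hBm : On B m) :
    l ≤ m := by
  induction A using Projectivization.ind with
  | h v hv =>
  induction B using Projectivization.ind with
  | h w hw =>
  have h : ∀ a : F, a • v ≠ w := fun a ha =>
    hAB ((Projectivization.mk_eq_mk_iff' F v w hv hw).2
      ⟨a⁻¹, by
        have : a ≠ 0 := by rintro rfl; exact hw (by simpa using ha.symm)
        rw [← ha, smul_smul, inv_mul_cancel₀ this, one_smul]⟩)
  rw [← eq_span_pair hl hv h (on_mk.1 hAl) (on_mk.1 hBl), Submodule.span_le]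
  rintro x (rfl | rfl)
  exacts [on_mk.1 hAm, on_mk.1 hBm]

end General

/-- The counting principle behind every product formula below: a disjoint union of classes of equal
size. -/
theorem ncard_biUnion_eq_mul {ι α : Type*} {t : Set ι} (ht : t.Finite) {s : ι → Set α} {m : ℕ}
    (hs : ∀ i ∈ t, (s i).Finite) (hm : ∀ i ∈ t, (s i).ncard = m) (h : t.PairwiseDisjoint s) :
    (⋃ i ∈ t, s i).ncard = t.ncard * m := by
  rw [ht.ncard_biUnion hs h, finsum_mem_congr rfl hm, finsum_mem_eq_finite_toFinset_sum _ ht,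
    Finset.sum_const, smul_eq_mul, Set.ncard_eq_toFinset_card t ht]

end BoseRep

namespace BoseRep

/-! ### The cyclic cubic extension `L/K`: trace and Hilbert 90 -/

section CubicExtension

variable {K L : Type*} [Field K] [Field L] [Algebra K L]

theorem cubic_pow_three [Finite K] (hL : Module.finrank K L = 3) (f : L ≃ₐ[K] L) (x : L) :
    f (f (f x)) = x := by
  have : FiniteDimensional K L := Module.finite_of_finrank_pos (by omega)
  have : Finite L := Module.finite_of_finite K
  have hc : Nat.card (L ≃ₐ[K] L) = 3 := (IsGalois.card_aut_eq_finrank K L).trans hL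
  have h3 : f ^ 3 = 1 := by rw [← hc]; exact pow_card_eq_one'
  exact DFunLike.congr_fun h3 x

/-- The Galois group has prime order 3, so `f ≠ 1` generates it, and a fixed point of `f` is fixed
by the whole group. -/
theorem mem_range_algebraMap_of_fixed [Finite K] (hL : Module.finrank K L = 3) {f : L ≃ₐ[K] L}
    (hf : f ≠ 1) {x : L} (hx : f x = x) : ∃ a : K, algebraMap K L a = x := by
  have : FiniteDimensional K L := Module.finite_of_finrank_pos (by omega)
  have : Finite L := Module.finite_of_finite K
  have hc : Nat.card (L ≃ₐ[K] L) = 3 := (IsGalois.card_aut_eq_finrank K L).trans hL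
  refine (IsGalois.mem_range_algebraMap_iff_fixed x).2 fun h => ?_
  have : Fact (Nat.Prime 3) := ⟨Nat.prime_three⟩
  obtain ⟨k, hk⟩ := mem_powers_of_prime_card hc hf (g' := h)
  simp only at hk
  rw [← hk]
  clear hk
  induction k with
  | zero => simp
  | succ k ih => rw [pow_succ, AlgEquiv.mul_apply, hx, ih]

/-- Dedekind's independence of characters for the distinct automorphisms `1`, `f`, `f²`. -/
theorem exists_combination_ne_zero [Finite K] (hL : Module.finrank K L = 3) {f : L ≃ₐ[K] L}
    (hf : f ≠ 1) {a b c : L} (ha : a ≠ 0) : ∃ y, a * y + b * f y + c * f (f y) ≠ 0 := by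
  by_contra! h
  have hff : f * f ≠ 1 := by
    intro h2
    refine hf (AlgEquiv.ext fun x => ?_)
    have := cubic_pow_three hL f x
    rw [show f (f (f x)) = (f * f) (f x) from rfl, h2] at this
    exact this
  have hff' : f * f ≠ f := fun h2 => hf (mul_left_cancel (h2.trans (mul_one f).symm))
  let m : Fin 3 → (L →* L) := ![(1 : L ≃ₐ[K] L), f, (f * f : L ≃ₐ[K] L)]
  have hinj : Function.Injective (fun g : L ≃ₐ[K] L => (g : L →* L)) := fun g g' hg =>
    AlgEquiv.ext fun x => DFunLike.congr_fun hg x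
  have hm : Function.Injective m := by
    intro i j hij
    fin_cases i <;> fin_cases j <;> simp [m] at hij ⊢
    · exact hf (hinj hij).symm
    · exact hff (hinj hij).symm
    · exact hf (hinj hij)
    · exact hff' (hinj hij).symm
    · exact hff (hinj hij)
    · exact hff' (hinj hij)
  have hli := (linearIndependent_monoidHom L L).comp m hm
  rw [Fintype.linearIndependent_iff] at hli
  refine ha (hli ![a, b, c] ?_ 0)
  ext y
  simpa [Fin.sum_univ_three, m] using h y

/-- The multiplicative form of Hilbert's theorem 90 for a ratio that is a cube root of unity
in the base field. -/
theorem exists_eigenvector [Finite K] (hL : Module.finrank K L = 3) {f : L ≃ₐ[K] L}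
    (hf : f ≠ 1) {μ : K} (hμ : μ ^ 3 = 1) : ∃ x : L, x ≠ 0 ∧ f x = μ • x := by
  -- The Lagrange resolvent `y + μ² f y + μ f² y`: applying `f` multiplies it by `μ`, because `μ³ =
  -- 1`.
  obtain ⟨y, hy⟩ := exists_combination_ne_zero hL hf (a := 1)
    (b := algebraMap K L (μ ^ 2)) (c := algebraMap K L μ) one_ne_zero
  refine ⟨_, hy, ?_⟩
  have h3 : algebraMap K L μ ^ 3 = 1 := by rw [← map_pow, hμ, map_one]
  rw [Algebra.smul_def]
  simp only [map_add, map_mul, AlgEquiv.commutes, cubic_pow_three hL, map_one, map_pow]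
  linear_combination (-f y) * h3

/-- The quotient of two eigenvectors with the same eigenvalue is fixed by `f`, hence lies in `K`. -/
theorem exists_smul_of_eigenvectors [Finite K] (hL : Module.finrank K L = 3) {f : L ≃ₐ[K] L}
    (hf : f ≠ 1) {μ : K} {x y : L} (hx0 : x ≠ 0) (hx : f x = μ • x) (hy : f y = μ • y) :
    ∃ a : K, y = a • x := by
  have hμ : μ ≠ 0 := by
    rintro rfl
    exact hx0 (f.injective (by simpa using hx))
  have hμ' : algebraMap K L μ ≠ 0 := by simpa using hμ
  obtain ⟨a, ha⟩ := mem_range_algebraMap_of_fixed hL hf (x := y / x) (by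
    rw [map_div₀, hx, hy, Algebra.smul_def, Algebra.smul_def, mul_div_mul_left _ _ hμ'])
  refine ⟨a, ?_⟩
  rw [Algebra.smul_def, ha, div_mul_cancel₀ _ hx0]

/-- The trace form `x + f x + f² x`. -/
def traceMap (f : L ≃ₐ[K] L) : L →ₗ[K] L :=
  LinearMap.id + f.toLinearMap + f.toLinearMap ∘ₗ f.toLinearMap

theorem traceMap_apply (f : L ≃ₐ[K] L) (x : L) : traceMap f x = x + f x + f (f x) := rfl

theorem exists_traceMap_eq_one [Finite K] (hL : Module.finrank K L = 3) {f : L ≃ₐ[K] L}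
    (hf : f ≠ 1) : ∃ y, traceMap f y = 1 := by
  obtain ⟨y, hy⟩ := exists_combination_ne_zero hL hf (a := 1) (b := 1) (c := 1) one_ne_zero
  simp only [one_mul] at hy
  obtain ⟨a, ha⟩ := mem_range_algebraMap_of_fixed hL hf (x := y + f y + f (f y)) (by
    simp only [map_add, cubic_pow_three hL]; ring)
  have ha0 : a ≠ 0 := by
    rintro rfl
    exact hy (by rw [← ha, map_zero])
  refine ⟨a⁻¹ • y, ?_⟩
  rw [map_smul, traceMap_apply, ← ha, Algebra.smul_def, ← map_mul, inv_mul_cancel₀ ha0, map_one]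

/-- The trace takes values in `K` and attains 1, so its image has rank 1 and its kernel rank 3 - 1.
-/
theorem finrank_ker_traceMap [Finite K] (hL : Module.finrank K L = 3) {f : L ≃ₐ[K] L}
    (hf : f ≠ 1) : Module.finrank K (LinearMap.ker (traceMap f)) = 2 := by
  have : FiniteDimensional K L := Module.finite_of_finrank_pos (by omega)
  have h := LinearMap.finrank_range_add_finrank_ker (traceMap f)
  have hr : LinearMap.range (traceMap f) = Submodule.span K {1} := by
    refine le_antisymm ?_ ?_
    · rintro _ ⟨x, rfl⟩
      obtain ⟨a, ha⟩ := mem_range_algebraMap_of_fixed hL hf (x := traceMap f x) (by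
        simp only [traceMap_apply, map_add, cubic_pow_three hL]; ring)
      rw [← ha, Submodule.mem_span_singleton]
      exact ⟨a, (Algebra.algebraMap_eq_smul_one a).symm⟩
    · rw [Submodule.span_singleton_le_iff_mem]
      obtain ⟨y, hy⟩ := exists_traceMap_eq_one hL hf
      exact ⟨y, hy⟩
  rw [hr, finrank_span_singleton one_ne_zero, hL] at h
  omega

end CubicExtension

/-! ### Roots of `X² + X + 1` in a finite field -/

section CubeRoots

variable {K : Type*} [Field K]

variable (K) in
/-- The roots of `X² + X + 1`. -/
def omegaRoots : Set K := {μ | μ ^ 2 + μ + 1 = 0}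

theorem mem_omegaRoots {μ : K} : μ ∈ omegaRoots K ↔ μ ^ 2 + μ + 1 = 0 := Iff.rfl

theorem pow_three_of_mem_omegaRoots {μ : K} (h : μ ∈ omegaRoots K) : μ ^ 3 = 1 := by
  rw [mem_omegaRoots] at h
  linear_combination (μ - 1) * h

theorem mem_omegaRoots_of_pow_three {μ : K} (h : μ ^ 3 = 1) (h1 : μ ≠ 1) : μ ∈ omegaRoots K := by
  have : (μ - 1) * (μ ^ 2 + μ + 1) = 0 := by linear_combination h
  exact (mul_eq_zero.1 this).resolve_left (sub_ne_zero.2 h1)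

theorem natCast_eq_zero_iff_dvd_card [Finite K] {p : ℕ} (hp : p.Prime) :
    (p : K) = 0 ↔ p ∣ Nat.card K := by
  have := Fintype.ofFinite K
  obtain ⟨r, hr⟩ := CharP.exists K
  have : Fact r.Prime := ⟨CharP.char_is_prime K r⟩
  obtain ⟨m, hm⟩ := FiniteField.card K r
  rw [CharP.cast_eq_zero_iff K r, Nat.card_eq_fintype_card, hm.2]
  constructor
  · intro h
    rw [(Nat.prime_dvd_prime_iff_eq Fact.out hp).1 h]
    exact dvd_pow_self _ m.ne_zero
  · intro h
    rw [(Nat.prime_dvd_prime_iff_eq hp Fact.out).1 (hp.dvd_of_dvd_pow h)]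

theorem one_mem_omegaRoots_iff [Finite K] : (1 : K) ∈ omegaRoots K ↔ 3 ∣ Nat.card K := by
  rw [← natCast_eq_zero_iff_dvd_card (K := K) Nat.prime_three, mem_omegaRoots]
  norm_num

/-- Lagrange and Cauchy in the unit group, whose order is `q - 1`. -/
theorem exists_ne_one_pow_three_iff [Finite K] :
    (∃ μ : K, μ ≠ 1 ∧ μ ^ 3 = 1) ↔ 3 ∣ Nat.card K - 1 := by
  have := Fintype.ofFinite K
  classical
  have hu : Fintype.card Kˣ = Nat.card K - 1 := by
    rw [Fintype.card_units, Nat.card_eq_fintype_card]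
  have : Fact (Nat.Prime 3) := ⟨Nat.prime_three⟩
  constructor
  · rintro ⟨μ, h1, h3⟩
    have h0 : μ ≠ 0 := by rintro rfl; simp at h3
    have ho : orderOf (Units.mk0 μ h0) = 3 := orderOf_eq_prime (by ext; simpa using h3)
      (by simpa [Units.ext_iff] using h1)
    rw [← hu, ← ho]
    exact orderOf_dvd_card
  · intro h
    obtain ⟨x, hx⟩ := exists_prime_orderOf_dvd_card 3 (hu ▸ h)
    refine ⟨x, ?_, ?_⟩
    · intro h1
      rw [Units.val_eq_one] at h1
      simp [h1] at hx
    · rw [← Units.val_pow_eq_pow_val, ← hx, pow_orderOf_eq_one, Units.val_one]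

theorem ncard_omegaRoots [Finite K] {n : ℤ} (hn : n = -1 ∨ n = 0 ∨ n = 1)
    (hq : (Nat.card K : ℤ) ≡ n [ZMOD 3]) : ((omegaRoots K).ncard : ℤ) = n + 1 := by
  have hpos : 0 < Nat.card K := Nat.card_pos
  have h1 := one_mem_omegaRoots_iff (K := K)
  have h3 := exists_ne_one_pow_three_iff (K := K)
  rw [Int.ModEq] at hq
  rcases hn with rfl | rfl | rfl
  · have : omegaRoots K = ∅ := by
      ext μ
      simp only [Set.mem_empty_iff_false, iff_false]
      intro hμ
      by_cases h : μ = 1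
      · have := h1.1 (h ▸ hμ)
        omega
      · have := h3.1 ⟨μ, h, pow_three_of_mem_omegaRoots hμ⟩
        omega
    simp [this]
  · have : omegaRoots K = {1} := by
      ext μ
      rw [Set.mem_singleton_iff]
      constructor
      · intro hμ
        by_contra h
        have := h3.1 ⟨μ, h, pow_three_of_mem_omegaRoots hμ⟩
        omega
      · rintro rfl
        exact h1.2 (by omega)
    simp [this]
  · obtain ⟨ω, hω1, hω3⟩ := h3.2 (by omega)
    have hω := mem_omegaRoots_of_pow_three hω3 hω1
    have hne : (1 : K) ∉ omegaRoots K := fun h => by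
      have := h1.1 h
      omega
    rw [mem_omegaRoots] at hω
    have : omegaRoots K = {ω, -1 - ω} := by
      ext μ
      rw [Set.mem_insert_iff, Set.mem_singleton_iff, mem_omegaRoots]
      constructor
      · intro hμ
        have : (μ - ω) * (μ - (-1 - ω)) = 0 := by linear_combination hμ - hω
        rcases mul_eq_zero.1 this with h | h
        · exact Or.inl (sub_eq_zero.1 h)
        · exact Or.inr (sub_eq_zero.1 h)
      · rintro (rfl | rfl)
        · exact hω
        · linear_combination hω
    rw [this, Set.ncard_pair]
    · norm_num
    · intro h
      apply hne
      rw [mem_omegaRoots]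
      -- The discriminant is -3: since `4 (ω² + ω + 1) = (2 ω + 1)² + 3`, a double root would force
      -- `3 = 0`.
      linear_combination 4 * hω - (2 * ω + 1) * h

end CubeRoots

end BoseRep

namespace BoseRep

/-! ### The spread: from points of `PG(8, q)` to points of `PG(2, q³)` -/

section SpreadPoint

variable {K L V : Type*} [Field K] [Field L] [Algebra K L] [AddCommGroup V]
  [Module K V] [Module L V] [IsScalarTower K L V]

variable (L) in
/-- The point of `PG(2, q³)` whose spread element contains a given point of `PG(8, q)`. -/
noncomputable def spreadPoint (A : ℙ K V) : ℙ L V :=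
  Projectivization.mk L A.rep A.rep_nonzero

theorem spreadPoint_mk {v : V} (hv : v ≠ 0) :
    spreadPoint L (Projectivization.mk K v hv) = Projectivization.mk L v hv := by
  obtain ⟨a, ha⟩ := Projectivization.exists_smul_eq_mk_rep K v hv
  refine (Projectivization.mk_eq_mk_iff' L _ _ _ _).2 ⟨algebraMap K L a, ?_⟩
  rw [algebraMap_smul, ← ha, Units.smul_def]

/-- The spread elements partition the points, so incidence with a spread element becomes an equation
for the function `spreadPoint`. -/
theorem on_sPlane_iff {A : ℙ K V} {P : ℙ L V} : On A (sPlane K P) ↔ spreadPoint L A = P := by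
  induction A using Projectivization.ind with
  | h v hv =>
  induction P using Projectivization.ind with
  | h w hw =>
  rw [on_mk, spreadPoint_mk, Projectivization.mk_eq_mk_iff', sPlane,
    Submodule.restrictScalars_mem, Projectivization.submodule_mk, Submodule.mem_span_singleton]

theorem isIPoint_iff {φ : Equiv.Perm (ℙ L V)} {A : ℙ K V} :
    IsIPoint φ A ↔ IsTypeI φ (spreadPoint L A) := by
  constructor
  · rintro ⟨P, hP, hA⟩
    rwa [on_sPlane_iff.1 hA]
  · exact fun h => ⟨_, h, on_sPlane_iff.2 rfl⟩

theorem isIIPoint_iff {φ : Equiv.Perm (ℙ L V)} {A : ℙ K V} :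
    IsIIPoint φ A ↔ IsTypeII φ (spreadPoint L A) := by
  constructor
  · rintro ⟨P, hP, hA⟩
    rwa [on_sPlane_iff.1 hA]
  · exact fun h => ⟨_, h, on_sPlane_iff.2 rfl⟩

theorem not_disjoint_sPlane_iff {l : Submodule K V} {P : ℙ L V} :
    ¬ Disjoint l (sPlane K P) ↔ ∃ A : ℙ K V, On A l ∧ spreadPoint L A = P := by
  constructor
  · intro h
    obtain ⟨A, h1, h2⟩ := exists_on_of_not_disjoint h
    exact ⟨A, h1, on_sPlane_iff.1 h2⟩
  · rintro ⟨A, h1, h2⟩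
    exact not_disjoint_of_on h1 (on_sPlane_iff.2 h2)

/-- Applied over both fields: to the orbit of a point of `PG(8, q)` and to the orbit of its spread
element. -/
theorem collinear_of_add_eq_zero {u v w : V} (hu : u ≠ 0) (hv : v ≠ 0) (hw : w ≠ 0)
    (h : u + v + w = 0) (hne : Projectivization.mk L u hu ≠ Projectivization.mk L v hv) :
    Collinear (Projectivization.mk L u hu) (Projectivization.mk L v hv)
      (Projectivization.mk L w hw) := by
  refine ⟨Submodule.span L {u, v}, ?_, on_mk.2 (Submodule.subset_span (by simp)),
    on_mk.2 (Submodule.subset_span (by simp)), on_mk.2 ?_⟩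
  · refine finrank_span_pair_eq_two hu fun a ha => hne.symm ?_
    exact (Projectivization.mk_eq_mk_iff' L _ _ _ _).2 ⟨a, ha⟩
  · rw [Submodule.mem_span_pair]
    refine ⟨-1, -1, ?_⟩
    rw [neg_one_smul, neg_one_smul, eq_comm, ← sub_eq_zero, ← h]
    abel

end SpreadPoint

/-! ### The normal form `τ`, its eigenspaces and the kernel of `1 + τ + τ²` -/

section CoordinateFrobenius

variable {K L V : Type*} [Field K] [Field L] [Algebra K L] [AddCommGroup V]
  [Module K V] [Module L V] [IsScalarTower K L V]

/-- `τ` applies the field automorphism `f ≠ 1` to the coordinates with respect to `b`. -/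
structure IsCoordinateFrobenius (f : L ≃ₐ[K] L) (b : Module.Basis (Fin 3) L V)
    (τ : V ≃ₗ[K] V) : Prop where
  ne_one : f ≠ 1
  map_smul : ∀ (x : L) (v : V), τ (x • v) = f x • τ v
  map_basis : ∀ i, τ (b i) = b i

/-- The eigenspace of `τ` for the eigenvalue `μ`. -/
def eigen (τ : V ≃ₗ[K] V) (μ : K) : Submodule K V :=
  LinearMap.ker ((τ : V →ₗ[K] V) - μ • LinearMap.id)

theorem mem_eigen {τ : V ≃ₗ[K] V} {μ : K} {v : V} : v ∈ eigen τ μ ↔ τ v = μ • v := by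
  simp [eigen, sub_eq_zero]

theorem mem_eigen_one {τ : V ≃ₗ[K] V} {v : V} : v ∈ eigen τ 1 ↔ τ v = v := by
  rw [mem_eigen, one_smul]

theorem eigenvalue_unique {τ : V ≃ₗ[K] V} {μ ν : K} {v : V} (hv : v ≠ 0) (h : v ∈ eigen τ μ)
    (h' : v ∈ eigen τ ν) : μ = ν := by
  rw [mem_eigen] at h h'
  exact smul_left_injective K hv (h.symm.trans h')

/-- The map `1 + τ + τ²`. -/
def normMap (τ : V ≃ₗ[K] V) : V →ₗ[K] V :=
  LinearMap.id + (τ : V →ₗ[K] V) + (τ : V →ₗ[K] V) ∘ₗ (τ : V →ₗ[K] V)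

theorem normMap_apply (τ : V ≃ₗ[K] V) (v : V) : normMap τ v = v + τ v + τ (τ v) := rfl

/-- The kernel of `1 + τ + τ²`. -/
def normKer (τ : V ≃ₗ[K] V) : Submodule K V := LinearMap.ker (normMap τ)

theorem mem_normKer {τ : V ≃ₗ[K] V} {v : V} : v ∈ normKer τ ↔ v + τ v + τ (τ v) = 0 := Iff.rfl

/-- On an eigenvector, `1 + τ + τ²` is multiplication by `μ² + μ + 1`. -/
theorem mem_normKer_iff_of_mem_eigen {τ : V ≃ₗ[K] V} {μ : K} {v : V} (hv : v ∈ eigen τ μ)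
    (h0 : v ≠ 0) : v ∈ normKer τ ↔ μ ∈ omegaRoots K := by
  rw [mem_eigen] at hv
  have : v + τ v + τ (τ v) = (μ ^ 2 + μ + 1) • v := by
    rw [hv, map_smul, hv]
    module
  rw [mem_normKer, mem_omegaRoots, this, smul_eq_zero_iff_left h0]

theorem eigen_le_normKer {τ : V ≃ₗ[K] V} {μ : K} (hμ : μ ∈ omegaRoots K) :
    eigen τ μ ≤ normKer τ := by
  intro v hv
  by_cases h0 : v = 0
  · simp [h0]
  · exact (mem_normKer_iff_of_mem_eigen hv h0).2 hμ

namespace IsCoordinateFrobenius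

variable {f : L ≃ₐ[K] L} {b : Module.Basis (Fin 3) L V} {τ : V ≃ₗ[K] V}

theorem repr_apply (h : IsCoordinateFrobenius f b τ) (v : V) (i : Fin 3) :
    b.repr (τ v) i = f (b.repr v i) := by
  have hv : τ v = ∑ i, f (b.repr v i) • b i := by
    conv_lhs => rw [← b.sum_repr v, map_sum]
    exact Finset.sum_congr rfl fun i _ => by rw [h.map_smul, h.map_basis]
  rw [hv, b.repr_sum_self]

theorem mem_eigen_iff (h : IsCoordinateFrobenius f b τ) {μ : K} {v : V} :
    v ∈ eigen τ μ ↔ ∀ i, f (b.repr v i) = μ • b.repr v i := by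
  rw [mem_eigen, b.ext_elem_iff]
  refine forall_congr' fun i => ?_
  rw [h.repr_apply, ← algebraMap_smul L μ v, _root_.map_smul, Finsupp.smul_apply, algebraMap_smul]

theorem finrank_eq_nine (b : Module.Basis (Fin 3) L V) (hL : Module.finrank K L = 3) :
    Module.finrank K V = 9 := by
  rw [← Module.finrank_mul_finrank K L V, hL, Module.finrank_eq_card_basis b, Fintype.card_fin]

variable [Finite K]

theorem apply_three (h : IsCoordinateFrobenius f b τ) (hL : Module.finrank K L = 3) (v : V) :
    τ (τ (τ v)) = v := by
  refine b.ext_elem fun i => ?_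
  rw [h.repr_apply, h.repr_apply, h.repr_apply, cubic_pow_three hL]

theorem eigen_one_eq_span (h : IsCoordinateFrobenius f b τ) (hL : Module.finrank K L = 3) :
    eigen τ 1 = Submodule.span K (Set.range b) := by
  refine le_antisymm ?_ ?_
  · intro v hv
    rw [← b.sum_repr v]
    refine Submodule.sum_mem _ fun i _ => ?_
    obtain ⟨a, ha⟩ := mem_range_algebraMap_of_fixed hL h.ne_one (x := b.repr v i) (by
      rw [h.mem_eigen_iff.1 hv, one_smul])
    rw [← ha, algebraMap_smul]
    exact Submodule.smul_mem _ _ (Submodule.subset_span ⟨i, rfl⟩)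
  · rw [Submodule.span_le]
    rintro _ ⟨i, rfl⟩
    exact mem_eigen_one.2 (h.map_basis i)

theorem finrank_eigen_one (h : IsCoordinateFrobenius f b τ) (hL : Module.finrank K L = 3) :
    Module.finrank K (eigen τ 1) = 3 := by
  rw [h.eigen_one_eq_span hL, finrank_span_eq_card (b.linearIndependent.restrict_scalars' K),
    Fintype.card_fin]

/-- If `f x = μ x` with `x ≠ 0`, multiplication by `x` carries the fixed space of `τ` isomorphically
onto the eigenspace of `μ`. -/
theorem finrank_eigen (h : IsCoordinateFrobenius f b τ) (hL : Module.finrank K L = 3) {μ : K}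
    (hμ : μ ^ 3 = 1) : Module.finrank K (eigen τ μ) = 3 := by
  obtain ⟨x, hx0, hx⟩ := exists_eigenvector hL h.ne_one hμ
  have hμ0 : μ ≠ 0 := by rintro rfl; simp at hμ
  let e : V ≃ₗ[K] V := (LinearEquiv.smulOfNeZero L V x hx0).restrictScalars K
  have he : ∀ v, e v = x • v := fun _ => rfl
  have hmap : (eigen τ 1).map (e : V →ₗ[K] V) = eigen τ μ := by
    ext w
    rw [Submodule.mem_map]
    constructor
    · rintro ⟨v, hv, rfl⟩
      rw [mem_eigen_one] at hv
      rw [mem_eigen, LinearEquiv.coe_coe, he, h.map_smul, hv, hx, smul_assoc]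
    · intro hw
      rw [mem_eigen] at hw
      refine ⟨x⁻¹ • w, ?_, ?_⟩
      · rw [mem_eigen_one, h.map_smul, hw, map_inv₀, hx, ← algebraMap_smul L μ w, smul_smul,
          Algebra.smul_def, mul_inv_rev, mul_assoc, inv_mul_cancel₀ (by simpa using hμ0), mul_one]
      · rw [LinearEquiv.coe_coe, he, smul_smul, mul_inv_cancel₀ hx0, one_smul]
  rw [← hmap, LinearEquiv.finrank_map_eq, h.finrank_eigen_one hL]

/-- A fixed vector `v` is the image of `y v` for any `y` of trace 1. -/
theorem range_normMap (h : IsCoordinateFrobenius f b τ) (hL : Module.finrank K L = 3) :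
    LinearMap.range (normMap τ) = eigen τ 1 := by
  refine le_antisymm ?_ ?_
  · rintro _ ⟨v, rfl⟩
    rw [mem_eigen_one, normMap_apply, map_add, map_add, h.apply_three hL]
    abel
  · intro v hv
    rw [mem_eigen_one] at hv
    obtain ⟨y, hy⟩ := exists_traceMap_eq_one hL h.ne_one
    refine ⟨y • v, ?_⟩
    rw [normMap_apply, h.map_smul, hv, h.map_smul, hv, ← add_smul, ← add_smul,
      ← traceMap_apply, hy, one_smul]

theorem finrank_normKer (h : IsCoordinateFrobenius f b τ) (hL : Module.finrank K L = 3) :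
    Module.finrank K (normKer τ) = 6 := by
  have h9 : Module.finrank K V = 9 := finrank_eq_nine b hL
  have : FiniteDimensional K V := Module.finite_of_finrank_pos (by omega)
  have := LinearMap.finrank_range_add_finrank_ker (normMap τ)
  rw [h.range_normMap hL, h.finrank_eigen_one hL, h9] at this
  rw [normKer]
  omega

/-- The only 6-dimensional subspace with trivial action on the quotient is the kernel of the
norm map. -/
theorem eq_normKer (h : IsCoordinateFrobenius f b τ) (hL : Module.finrank K L = 3)
    {U : Submodule K V} (hU : Module.finrank K U = 6) (hτ : ∀ v, τ v - v ∈ U) :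
    U = normKer τ := by
  have h9 : Module.finrank K V = 9 := finrank_eq_nine b hL
  have : FiniteDimensional K V := Module.finite_of_finrank_pos (by omega)
  have h6 := LinearMap.finrank_range_add_finrank_ker ((τ : V →ₗ[K] V) - (1 : K) • LinearMap.id)
  rw [← eigen, h.finrank_eigen_one hL, h9] at h6
  -- The image of `τ - 1` has rank 9 - 3 = 6 and lies in `U`, so it fills `U`; it is annihilated by
  -- `1 + τ + τ²` since `τ³ = 1`.
  have h1 : LinearMap.range ((τ : V →ₗ[K] V) - (1 : K) • LinearMap.id) = U := by
    refine Submodule.eq_of_le_of_finrank_eq ?_ (by omega)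
    rintro _ ⟨v, rfl⟩
    simpa using hτ v
  refine Submodule.eq_of_le_of_finrank_eq ?_ (by rw [hU, h.finrank_normKer hL])
  rw [← h1]
  rintro _ ⟨v, rfl⟩
  simp only [mem_normKer, LinearMap.sub_apply, LinearEquiv.coe_coe,
    LinearMap.id_apply, one_smul, map_sub, h.apply_three hL]
  abel

end IsCoordinateFrobenius

end CoordinateFrobenius

end BoseRep

namespace BoseRep

/-! ### Objects fixed by `τ`, sorted by eigenvalue -/

namespace IsCoordinateFrobenius

variable {K L V : Type*} [Field K] [Field L] [Algebra K L] [AddCommGroup V]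
  [Module K V] [Module L V] [IsScalarTower K L V] [Finite K] [Finite V]
  {f : L ≃ₐ[K] L} {b : Module.Basis (Fin 3) L V} {τ : V ≃ₗ[K] V} {φ : Equiv.Perm (ℙ L V)}

/-! ### Fixed points, lines and planes -/

/-- Fixed points are spanned by eigenvectors. Inside `normKer τ` only roots of `X² + X + 1` occur as
eigenvalues, and distinct eigenvalues share no point. -/
theorem ncard_fixed_on {U : Submodule K V} (hU : U ≤ normKer τ) {d : ℕ}
    (hd : ∀ μ ∈ omegaRoots K, Module.finrank K (U ⊓ eigen τ μ : Submodule K V) = d) :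
    {A : ℙ K V | On A U ∧ act τ A = A}.ncard =
      (omegaRoots K).ncard * ∑ i ∈ Finset.range d, Nat.card K ^ i := by
  rw [← ncard_biUnion_eq_mul (Set.toFinite _) (s := fun μ => {A : ℙ K V | On A (U ⊓ eigen τ μ)})
    (fun _ _ => Set.toFinite _) (fun μ hμ => ncard_setOf_on _ (hd μ hμ))]
  · congr 1
    ext A
    simp only [Set.mem_iUnion, Set.mem_ofPred_eq, exists_prop]
    induction A using Projectivization.ind with
    | h v hv =>
    rw [act_mk_eq_self_iff, on_mk]
    simp only [on_mk, Submodule.mem_inf, mem_eigen]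
    constructor
    · rintro ⟨h1, μ, h2⟩
      exact ⟨μ, (mem_normKer_iff_of_mem_eigen (mem_eigen.2 h2) hv).1 (hU h1), h1, h2⟩
    · rintro ⟨μ, -, h1, h2⟩
      exact ⟨h1, μ, h2⟩
  · intro μ _ ν _ hne
    refine Set.disjoint_left.2 fun A hA hA' => ?_
    induction A using Projectivization.ind with
    | h v hv =>
    simp only [Set.mem_ofPred_eq, on_mk, Submodule.mem_inf] at hA hA'
    exact hne (eigenvalue_unique hv hA.2 hA'.2)

theorem ncard_fixed_on_normKer (h : IsCoordinateFrobenius f b τ) (hL : Module.finrank K L = 3) :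
    {A : ℙ K V | On A (normKer τ) ∧ act τ A = A}.ncard =
      (omegaRoots K).ncard * (Nat.card K ^ 2 + Nat.card K + 1) := by
  rw [ncard_fixed_on le_rfl (d := 3)]
  · simp only [Finset.sum_range_succ, Finset.sum_range_zero]
    ring
  · intro μ hμ
    rw [inf_eq_right.2 (eigen_le_normKer hμ), h.finrank_eigen hL (pow_three_of_mem_omegaRoots hμ)]

theorem ncard_ptwiseFixedLine (h : IsCoordinateFrobenius f b τ) (hL : Module.finrank K L = 3) :
    {l : Submodule K V | l ≤ normKer τ ∧ IsPtwiseFixedLine τ l}.ncard =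
      (omegaRoots K).ncard * (Nat.card K ^ 2 + Nat.card K + 1) := by
  rw [← ncard_biUnion_eq_mul (Set.toFinite _)
    (s := fun μ => {l : Submodule K V | l ≤ eigen τ μ ∧ Module.finrank K l = 2})
    (fun _ _ => Set.toFinite _) (fun μ hμ => ncard_setOf_le_finrank_eq_two _
      (h.finrank_eigen hL (pow_three_of_mem_omegaRoots hμ)))]
  · congr 1
    ext l
    simp only [Set.mem_iUnion, Set.mem_ofPred_eq, exists_prop, IsPtwiseFixedLine,
      IsSubspaceOfDim, isPtwiseFixed_iff]
    constructor
    · rintro ⟨hl, h2, μ, hμ⟩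
      obtain ⟨v, hv, h0⟩ := l.exists_mem_ne_zero_of_ne_bot (by rintro rfl; simp at h2)
      exact ⟨μ, (mem_normKer_iff_of_mem_eigen (mem_eigen.2 (hμ v hv)) h0).1 (hl hv),
        fun w hw => mem_eigen.2 (hμ w hw), h2⟩
    · rintro ⟨μ, hR, hl, h2⟩
      exact ⟨hl.trans (eigen_le_normKer hR), h2, μ, fun v hv => mem_eigen.1 (hl hv)⟩
  · intro μ _ ν _ hne
    refine Set.disjoint_left.2 fun l hl hl' => ?_
    obtain ⟨v, hv, h0⟩ := l.exists_mem_ne_zero_of_ne_bot (by rintro rfl; simp at hl)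
    exact hne (eigenvalue_unique h0 (hl.1 hv) (hl'.1 hv))

/-- A plane fixed pointwise lies in one eigenspace; `τ³ = 1` makes the eigenvalue a cube root of
unity, and then both have rank 3. -/
theorem isPtwiseFixedPlane_iff (h : IsCoordinateFrobenius f b τ) (hL : Module.finrank K L = 3)
    {π : Submodule K V} : IsPtwiseFixedPlane τ π ↔ ∃ μ : K, μ ^ 3 = 1 ∧ π = eigen τ μ := by
  rw [IsPtwiseFixedPlane, IsSubspaceOfDim, isPtwiseFixed_iff]
  constructor
  · rintro ⟨h3, μ, hμ⟩
    obtain ⟨v, hv, h0⟩ := π.exists_mem_ne_zero_of_ne_bot (by rintro rfl; simp at h3)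
    have h1 : μ ^ 3 = 1 := by
      have := h.apply_three hL v
      rw [hμ v hv, _root_.map_smul, hμ v hv, _root_.map_smul, _root_.map_smul, hμ v hv,
        smul_smul, smul_smul] at this
      refine smul_left_injective K h0 ?_
      simp only [one_smul]
      rw [← this]
      congr 1
      ring
    refine ⟨μ, h1, Submodule.eq_of_le_of_finrank_eq (fun w hw => mem_eigen.2 (hμ w hw)) ?_⟩
    rw [h3, h.finrank_eigen hL h1]
  · rintro ⟨μ, h1, rfl⟩
    exact ⟨h.finrank_eigen hL h1, μ, fun v hv => mem_eigen.1 hv⟩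

theorem exists_mem_eigen (h : IsCoordinateFrobenius f b τ) (hL : Module.finrank K L = 3)
    {μ : K} (hμ : μ ^ 3 = 1) : ∃ v ∈ eigen τ μ, v ≠ 0 := by
  refine (eigen τ μ).exists_mem_ne_zero_of_ne_bot fun h0 => ?_
  have := h.finrank_eigen hL hμ
  rw [h0, finrank_bot] at this
  omega

theorem eigen_le_normKer_iff (h : IsCoordinateFrobenius f b τ) (hL : Module.finrank K L = 3)
    {μ : K} (hμ : μ ^ 3 = 1) : eigen τ μ ≤ normKer τ ↔ μ ∈ omegaRoots K := by
  refine ⟨fun hle => ?_, eigen_le_normKer⟩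
  obtain ⟨v, hv, h0⟩ := h.exists_mem_eigen hL hμ
  exact (mem_normKer_iff_of_mem_eigen hv h0).1 (hle hv)

theorem ncard_ptwiseFixedPlane_le (h : IsCoordinateFrobenius f b τ)
    (hL : Module.finrank K L = 3) :
    {π : Submodule K V | IsPtwiseFixedPlane τ π ∧ π ≤ normKer τ}.ncard =
      (omegaRoots K).ncard := by
  have : {π : Submodule K V | IsPtwiseFixedPlane τ π ∧ π ≤ normKer τ} =
      eigen τ '' omegaRoots K := by
    ext π
    rw [Set.mem_ofPred_eq, h.isPtwiseFixedPlane_iff hL, Set.mem_image]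
    constructor
    · rintro ⟨⟨μ, hμ, rfl⟩, hle⟩
      exact ⟨μ, (h.eigen_le_normKer_iff hL hμ).1 hle, rfl⟩
    · rintro ⟨μ, hμ, rfl⟩
      exact ⟨⟨μ, pow_three_of_mem_omegaRoots hμ, rfl⟩, eigen_le_normKer hμ⟩
  rw [this]
  refine Set.InjOn.ncard_image fun μ hμ ν _ heq => ?_
  obtain ⟨v, hv, h0⟩ := h.exists_mem_eigen hL (pow_three_of_mem_omegaRoots hμ)
  exact eigenvalue_unique h0 hv (heq ▸ hv)

/-- The only cube root of unity that can fail to be a root of `X² + X + 1` is 1; in characteristic 3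
it is a root and the set is empty. -/
theorem ptwiseFixedPlane_not_le (h : IsCoordinateFrobenius f b τ)
    (hL : Module.finrank K L = 3) :
    {π : Submodule K V | IsPtwiseFixedPlane τ π ∧ ¬ π ≤ normKer τ} =
      {π | π = eigen τ 1 ∧ (1 : K) ∉ omegaRoots K} := by
  ext π
  rw [Set.mem_ofPred_eq, h.isPtwiseFixedPlane_iff hL, Set.mem_ofPred_eq]
  constructor
  · rintro ⟨⟨μ, hμ, rfl⟩, hle⟩
    rw [h.eigen_le_normKer_iff hL hμ] at hle
    have : μ = 1 := by
      by_contra h1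
      exact hle (mem_omegaRoots_of_pow_three hμ h1)
    subst this
    exact ⟨rfl, hle⟩
  · rintro ⟨rfl, h1⟩
    exact ⟨⟨1, one_pow 3, rfl⟩, by rwa [h.eigen_le_normKer_iff hL (one_pow 3)]⟩

theorem disjoint_normKer (h : IsCoordinateFrobenius f b τ) (hL : Module.finrank K L = 3)
    {π : Submodule K V} (hπ : IsPtwiseFixedPlane τ π) (hle : ¬ π ≤ normKer τ) :
    Disjoint π (normKer τ) := by
  obtain ⟨μ, hμ, rfl⟩ := (h.isPtwiseFixedPlane_iff hL).1 hπ
  rw [h.eigen_le_normKer_iff hL hμ] at hle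
  refine Submodule.disjoint_def.2 fun v hv hv' => ?_
  by_contra h0
  exact hle ((mem_normKer_iff_of_mem_eigen hv h0).1 hv')

/-- An invariant line in the kernel of the norm map that is not fixed pointwise contains exactly
one fixed point for each root of `X² + X + 1`. -/
theorem ncard_fixed_on_line {l : Submodule K V} (hl : l ≤ normKer τ)
    (h2 : Module.finrank K l = 2) (hinv : ∀ v ∈ l, τ v ∈ l) (hns : ¬ IsPtwiseFixed τ l) :
    {A : ℙ K V | On A l ∧ act τ A = A}.ncard = (omegaRoots K).ncard := by
  rw [ncard_fixed_on hl (d := 1)]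
  · simp
  · intro μ hμ
    have hle : Module.finrank K (l ⊓ eigen τ μ : Submodule K V) ≤ 2 :=
      h2 ▸ Submodule.finrank_mono inf_le_left
    have hne2 : Module.finrank K (l ⊓ eigen τ μ : Submodule K V) ≠ 2 := by
      intro h
      have heq := Submodule.eq_of_le_of_finrank_eq (inf_le_left : l ⊓ eigen τ μ ≤ l) (h.trans h2.symm)
      exact hns ((isPtwiseFixed_iff τ l).2
        ⟨μ, fun v hv => mem_eigen.1 (inf_eq_left.1 heq hv)⟩)
    -- On `l` the product `(τ - μ)(τ - (-1 - μ)) = τ² + τ + 1` vanishes. If `μ` had no eigenvector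
    -- in `l`, then `τ` would be the other root `-1 - μ` on all of `l`.
    have hne0 : Module.finrank K (l ⊓ eigen τ μ : Submodule K V) ≠ 0 := by
      intro h
      rw [Submodule.finrank_eq_zero] at h
      refine hns fun A hA => ?_
      induction A using Projectivization.ind with
      | h v hv =>
      rw [act_mk_eq_self_iff]
      refine ⟨-1 - μ, ?_⟩
      rw [on_mk] at hA
      have hm : τ v - (-1 - μ) • v ∈ l ⊓ eigen τ μ := by
        refine ⟨l.sub_mem (hinv v hA) (l.smul_mem _ hA), mem_eigen.2 ?_⟩
        have h1 := mem_normKer.1 (hl hA)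
        have h3 : τ (τ v) = -v - τ v := by
          rw [← sub_eq_zero, ← h1]
          abel
        rw [mem_omegaRoots] at hμ
        rw [_root_.map_sub, _root_.map_smul, h3]
        have h4 : (μ ^ 2 + μ + 1) • v = 0 := by rw [hμ, zero_smul]
        rw [← sub_eq_zero, ← neg_eq_zero, ← h4]
        module
      rw [h, Submodule.mem_bot, sub_eq_zero] at hm
      exact hm
    omega

end IsCoordinateFrobenius

end BoseRep

namespace BoseRep

namespace IsCoordinateFrobenius

variable {K L V : Type*} [Field K] [Field L] [Algebra K L] [AddCommGroup V]
  [Module K V] [Module L V] [IsScalarTower K L V] [Finite K] [Finite V]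
  {f : L ≃ₐ[K] L} {b : Module.Basis (Fin 3) L V} {τ : V ≃ₗ[K] V} {φ : Equiv.Perm (ℙ L V)}

/-! ### Points of Type I -/

theorem act_three (h : IsCoordinateFrobenius f b τ) (hL : Module.finrank K L = 3) (A : ℙ K V) :
    act τ (act τ (act τ A)) = A := by
  induction A using Projectivization.ind with
  | h v hv =>
  simp only [act_mk, h.apply_three hL]

theorem spreadPoint_surjective (P : ℙ L V) : ∃ A : ℙ K V, spreadPoint L A = P := by
  induction P using Projectivization.ind with
  | h v hv => exact ⟨Projectivization.mk K v hv, spreadPoint_mk hv⟩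

theorem perm_three (h : IsCoordinateFrobenius f b τ) (hL : Module.finrank K L = 3)
    (hφ : ∀ A : ℙ K V, φ (spreadPoint L A) = spreadPoint L (act τ A)) (P : ℙ L V) :
    φ (φ (φ P)) = P := by
  obtain ⟨A, rfl⟩ := spreadPoint_surjective (K := K) P
  rw [hφ, hφ, hφ, h.act_three hL]

/-- Scale a nonzero coordinate to 1. A vector that `τ` multiplies by some `y` in `L` then has `y =
1`, as `f 1 = 1`. -/
theorem exists_fixed_rep (h : IsCoordinateFrobenius f b τ)
    (hφ : ∀ A : ℙ K V, φ (spreadPoint L A) = spreadPoint L (act τ A)) {P : ℙ L V}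
    (hP : IsTypeI φ P) : ∃ (v : V) (hv : v ≠ 0), τ v = v ∧ P = Projectivization.mk L v hv := by
  induction P using Projectivization.ind with
  | h v hv =>
  obtain ⟨i, hi⟩ : ∃ i, b.repr v i ≠ 0 := by
    by_contra! h0
    exact hv (b.ext_elem fun i => by simp [h0])
  set x := b.repr v i
  have hx : x⁻¹ ≠ 0 := inv_ne_zero hi
  have hv' : x⁻¹ • v ≠ 0 := smul_ne_zero hx hv
  have heq : Projectivization.mk L v hv = Projectivization.mk L (x⁻¹ • v) hv' :=
    (Projectivization.mk_eq_mk_iff' L _ _ _ _).2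
      ⟨x, by rw [smul_smul, mul_inv_cancel₀ hi, one_smul]⟩
  refine ⟨x⁻¹ • v, hv', ?_, heq⟩
  rw [heq, IsTypeI, ← spreadPoint_mk (K := K), hφ, act_mk, spreadPoint_mk, spreadPoint_mk,
    Projectivization.mk_eq_mk_iff'] at hP
  obtain ⟨y, hy⟩ := hP
  have h1 : b.repr (x⁻¹ • v) i = 1 := by
    rw [_root_.map_smul, Finsupp.smul_apply, smul_eq_mul, inv_mul_cancel₀ hi]
  have h2 := congrArg (fun w => b.repr w i) hy
  simp only [h.repr_apply, h1, map_one] at h2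
  rw [_root_.map_smul, Finsupp.smul_apply, h1, smul_eq_mul, mul_one] at h2
  rw [← hy, h2, one_smul]

theorem isTypeI_mk (hφ : ∀ A : ℙ K V, φ (spreadPoint L A) = spreadPoint L (act τ A)) {v : V}
    (hv : v ≠ 0) (h1 : τ v = v) : IsTypeI φ (Projectivization.mk L v hv) := by
  rw [IsTypeI, ← spreadPoint_mk (K := K), hφ, act_mk]
  simp only [h1]

/-- Type I points correspond to points of the fixed space of `τ`: if two fixed vectors are
proportional over `L`, their ratio is fixed by `f` and so lies in `K`. -/
theorem ncard_isTypeI (h : IsCoordinateFrobenius f b τ) (hL : Module.finrank K L = 3)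
    (hφ : ∀ A : ℙ K V, φ (spreadPoint L A) = spreadPoint L (act τ A)) :
    {P : ℙ L V | IsTypeI φ P}.ncard = Nat.card K ^ 2 + Nat.card K + 1 := by
  have h3 := ncard_setOf_on (eigen τ 1) (h.finrank_eigen_one hL)
  have : {P : ℙ L V | IsTypeI φ P} = spreadPoint L '' {A : ℙ K V | On A (eigen τ 1)} := by
    ext P
    rw [Set.mem_ofPred_eq, Set.mem_image]
    constructor
    · intro hP
      obtain ⟨v, hv, h1, rfl⟩ := h.exists_fixed_rep hφ hP
      exact ⟨Projectivization.mk K v hv, on_mk.2 (mem_eigen_one.2 h1), spreadPoint_mk hv⟩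
    · rintro ⟨A, hA, rfl⟩
      induction A using Projectivization.ind with
      | h v hv =>
      rw [spreadPoint_mk]
      exact isTypeI_mk hφ hv (mem_eigen_one.1 (on_mk.1 hA))
  rw [this, Set.InjOn.ncard_image, h3]
  · simp only [Finset.sum_range_succ, Finset.sum_range_zero]
    ring
  · intro A hA B hB hAB
    induction A using Projectivization.ind with
    | h v hv =>
    induction B using Projectivization.ind with
    | h w hw =>
    rw [spreadPoint_mk, spreadPoint_mk, Projectivization.mk_eq_mk_iff'] at hAB
    rw [Set.mem_ofPred_eq, on_mk, mem_eigen_one] at hA hB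
    obtain ⟨y, hy⟩ := hAB
    have hfy : f y = y := by
      refine smul_left_injective L hw ?_
      simp only
      rw [hy, ← hA, ← hy, h.map_smul, hB]
    obtain ⟨a, ha⟩ := mem_range_algebraMap_of_fixed hL h.ne_one hfy
    refine (Projectivization.mk_eq_mk_iff' K _ _ _ _).2 ⟨a, ?_⟩
    rw [← hy, ← ha, algebraMap_smul]

theorem smul_mem_normKer_iff (h : IsCoordinateFrobenius f b τ) {v : V} (hv : v ≠ 0)
    (h1 : τ v = v) {x : L} : x • v ∈ normKer τ ↔ x ∈ LinearMap.ker (traceMap f) := by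
  rw [mem_normKer, h.map_smul, h1, h.map_smul, h1, ← add_smul, ← add_smul,
    smul_eq_zero_iff_left hv]
  rfl

/-- The line in which the spread element of a point of Type I meets the kernel of the norm map. -/
theorem finrank_sPlane_inf (h : IsCoordinateFrobenius f b τ) (hL : Module.finrank K L = 3)
    (hφ : ∀ A : ℙ K V, φ (spreadPoint L A) = spreadPoint L (act τ A)) {P : ℙ L V}
    (hP : IsTypeI φ P) : Module.finrank K (sPlane K P ⊓ normKer τ : Submodule K V) = 2 := by
  obtain ⟨v, hv, h1, rfl⟩ := h.exists_fixed_rep hφ hP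
  let e : L →ₗ[K] V := (LinearMap.toSpanSingleton L V v).restrictScalars K
  have he : ∀ x, e x = x • v := fun _ => rfl
  have hinj : Function.Injective e := smul_left_injective L hv
  have : (LinearMap.ker (traceMap f)).map e =
      sPlane K (Projectivization.mk L v hv) ⊓ normKer τ := by
    ext w
    rw [Submodule.mem_map, Submodule.mem_inf, sPlane, Submodule.restrictScalars_mem,
      Projectivization.submodule_mk, Submodule.mem_span_singleton]
    constructor
    · rintro ⟨x, hx, rfl⟩
      exact ⟨⟨x, rfl⟩, (h.smul_mem_normKer_iff hv h1).2 hx⟩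
    · rintro ⟨⟨x, rfl⟩, hx⟩
      exact ⟨x, (h.smul_mem_normKer_iff hv h1).1 hx, rfl⟩
  rw [← this, ← finrank_ker_traceMap hL h.ne_one]
  exact (Submodule.equivMapOfInjective e hinj _).finrank_eq.symm

/-- Otherwise `f` would be a scalar on the elements of trace zero, which have rank 2, whereas
eigenspaces of `f` have rank at most 1. -/
theorem not_isPtwiseFixed_sPlane_inf (h : IsCoordinateFrobenius f b τ)
    (hL : Module.finrank K L = 3)
    (hφ : ∀ A : ℙ K V, φ (spreadPoint L A) = spreadPoint L (act τ A)) {P : ℙ L V}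
    (hP : IsTypeI φ P) : ¬ IsPtwiseFixed τ (sPlane K P ⊓ normKer τ) := by
  have : FiniteDimensional K L := Module.finite_of_finrank_pos (by omega)
  obtain ⟨v, hv, h1, rfl⟩ := h.exists_fixed_rep hφ hP
  rw [isPtwiseFixed_iff]
  rintro ⟨μ, hμ⟩
  have hf : ∀ x ∈ LinearMap.ker (traceMap f), f x = μ • x := by
    intro x hx
    have := hμ (x • v) ⟨by
      change x • v ∈ (Projectivization.mk L v hv).submodule
      rw [Projectivization.submodule_mk]
      exact Submodule.smul_mem _ _ (Submodule.mem_span_singleton_self v),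
      (h.smul_mem_normKer_iff hv h1).2 hx⟩
    rw [h.map_smul, h1, ← smul_assoc] at this
    exact smul_left_injective L hv this
  have h2 := finrank_ker_traceMap hL h.ne_one
  obtain ⟨x, hx, hx0⟩ := (LinearMap.ker (traceMap f)).exists_mem_ne_zero_of_ne_bot (by
    intro h0
    rw [h0, finrank_bot] at h2
    omega)
  have hle : LinearMap.ker (traceMap f) ≤ Submodule.span K {x} := by
    intro y hy
    obtain ⟨a, rfl⟩ := exists_smul_of_eigenvectors hL h.ne_one hx0 (hf x hx) (hf y hy)
    exact Submodule.smul_mem _ _ (Submodule.mem_span_singleton_self x)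
  have := Submodule.finrank_mono hle
  rw [h2, finrank_span_singleton hx0] at this
  omega

theorem apply_mem_normKer (h : IsCoordinateFrobenius f b τ) (hL : Module.finrank K L = 3) {v : V}
    (hv : v ∈ normKer τ) : τ v ∈ normKer τ := by
  rw [mem_normKer] at hv ⊢
  rw [h.apply_three hL, ← hv]
  abel

theorem apply_mem_sPlane (hφ : ∀ A : ℙ K V, φ (spreadPoint L A) = spreadPoint L (act τ A))
    {P : ℙ L V} (hP : IsTypeI φ P) {v : V} (hv : v ∈ sPlane K P) : τ v ∈ sPlane K P := by
  by_cases h0 : v = 0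
  · simp [h0]
  · have h1 : On (act τ (Projectivization.mk K v h0)) (sPlane K P) := by
      rw [on_sPlane_iff, ← hφ, on_sPlane_iff.1 (on_mk.2 hv), hP]
    rwa [act_mk, on_mk] at h1

/-! ### Points of the kernel of the norm map -/

theorem isIPoint_of_fixed (hφ : ∀ A : ℙ K V, φ (spreadPoint L A) = spreadPoint L (act τ A))
    {A : ℙ K V} (hA : act τ A = A) : IsIPoint φ A := by
  rw [isIPoint_iff, IsTypeI, hφ, hA]

theorem collinear_orbit {A : ℙ K V} (hA : On A (normKer τ)) (hne : act τ A ≠ A) :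
    Collinear A (act τ A) (act τ (act τ A)) := by
  induction A using Projectivization.ind with
  | h v hv =>
  rw [on_mk, mem_normKer] at hA
  exact collinear_of_add_eq_zero _ _ _ hA (Ne.symm hne)

theorem isIColonPoint_iff (h : IsCoordinateFrobenius f b τ) (hL : Module.finrank K L = 3)
    {A : ℙ K V} (hA : On A (normKer τ)) :
    IsIColonPoint φ τ A ↔ IsIPoint φ A ∧ act τ A ≠ A := by
  constructor
  · rintro ⟨h1, h2, -⟩
    exact ⟨h1, h2.symm⟩
  · rintro ⟨h1, h2⟩
    have hinj : Function.Injective (act τ) := Projectivization.map_injective _ τ.injective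
    refine ⟨h1, h2.symm, fun h3 => h2 (hinj h3).symm, fun h3 => h2 ?_, collinear_orbit hA h2⟩
    have := h.act_three hL A
    rwa [← h3] at this

/-- The relation `v + τ v + τ² v = 0`, read over `L`, excludes a non-collinear orbit of the spread
element. Distinctness of the orbit follows from `φ³ = 1`. -/
theorem isIIPoint_iff_not_isIPoint (h : IsCoordinateFrobenius f b τ)
    (hL : Module.finrank K L = 3)
    (hφ : ∀ A : ℙ K V, φ (spreadPoint L A) = spreadPoint L (act τ A)) {A : ℙ K V}
    (hA : On A (normKer τ)) : IsIIPoint φ A ↔ ¬ IsIPoint φ A := by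
  rw [isIPoint_iff, isIIPoint_iff, IsTypeI]
  constructor
  · exact fun h1 h2 => h1.1 h2.symm
  · intro h1
    refine ⟨Ne.symm h1, fun h2 => h1 (φ.injective h2).symm, fun h2 => h1 ?_, ?_⟩
    · have := h.perm_three hL hφ (spreadPoint L A)
      rwa [← h2] at this
    · rw [hφ] at h1 ⊢
      rw [hφ]
      induction A using Projectivization.ind with
      | h v hv =>
      rw [on_mk, mem_normKer] at hA
      simp only [act_mk, spreadPoint_mk] at h1 ⊢
      exact collinear_of_add_eq_zero _ _ _ hA (Ne.symm h1)

theorem isIIColonPoint_iff (h : IsCoordinateFrobenius f b τ) (hL : Module.finrank K L = 3)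
    (hφ : ∀ A : ℙ K V, φ (spreadPoint L A) = spreadPoint L (act τ A)) {A : ℙ K V}
    (hA : On A (normKer τ)) : IsIIColonPoint φ τ A ↔ ¬ IsIPoint φ A := by
  rw [IsIIColonPoint, h.isIIPoint_iff_not_isIPoint hL hφ hA]
  exact ⟨fun h1 => h1.1, fun h1 => ⟨h1, collinear_orbit hA fun h2 => h1 (isIPoint_of_fixed hφ h2)⟩⟩

theorem ncard_isIPoint_on_normKer (h : IsCoordinateFrobenius f b τ)
    (hL : Module.finrank K L = 3)
    (hφ : ∀ A : ℙ K V, φ (spreadPoint L A) = spreadPoint L (act τ A)) :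
    {A : ℙ K V | On A (normKer τ) ∧ IsIPoint φ A}.ncard =
      (Nat.card K ^ 2 + Nat.card K + 1) * (Nat.card K + 1) := by
  have : Finite (ℙ L V) := inferInstance
  rw [← h.ncard_isTypeI hL hφ, ← ncard_biUnion_eq_mul (Set.toFinite _)
    (s := fun P => {A : ℙ K V | On A (sPlane K P ⊓ normKer τ)}) (fun _ _ => Set.toFinite _)]
  · congr 1
    ext A
    simp only [Set.mem_iUnion, Set.mem_ofPred_eq, exists_prop, on_inf, IsIPoint]
    constructor
    · rintro ⟨h1, P, h2, h3⟩
      exact ⟨P, h2, h3, h1⟩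
    · rintro ⟨P, h2, h3, h1⟩
      exact ⟨h1, P, h2, h3⟩
  · intro P hP
    rw [ncard_setOf_on _ (h.finrank_sPlane_inf hL hφ hP)]
    simp [Finset.sum_range_succ, add_comm]
  · intro P _ Q _ hne
    refine Set.disjoint_left.2 fun A hA hA' => hne ?_
    rw [← on_sPlane_iff.1 (on_inf.1 hA).1, ← on_sPlane_iff.1 (on_inf.1 hA').1]

theorem ncard_on_diff (s t : ℙ K V → Prop) (U : Submodule K V)
    (hst : ∀ A, On A U → t A → s A) :
    {A : ℙ K V | On A U ∧ t A}.ncard + {A : ℙ K V | On A U ∧ (s A ∧ ¬ t A)}.ncard =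
      {A : ℙ K V | On A U ∧ s A}.ncard := by
  rw [← Set.ncard_union_eq]
  · congr 1
    ext A
    simp only [Set.mem_union, Set.mem_ofPred_eq]
    have := hst A
    tauto
  · exact Set.disjoint_left.2 fun A hA hA' => hA'.2.2 hA.2

theorem ncard_isIColonPoint_on_normKer (h : IsCoordinateFrobenius f b τ)
    (hL : Module.finrank K L = 3)
    (hφ : ∀ A : ℙ K V, φ (spreadPoint L A) = spreadPoint L (act τ A)) :
    {A : ℙ K V | On A (normKer τ) ∧ act τ A = A}.ncard +
      {A : ℙ K V | On A (normKer τ) ∧ IsIColonPoint φ τ A}.ncard =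
      (Nat.card K ^ 2 + Nat.card K + 1) * (Nat.card K + 1) := by
  rw [← h.ncard_isIPoint_on_normKer hL hφ,
    ← ncard_on_diff (IsIPoint φ) (fun A => act τ A = A) _ fun A _ => isIPoint_of_fixed hφ]
  congr 2
  ext A
  exact and_congr_right fun hA => h.isIColonPoint_iff hL hA

/-- The II-points are all points of the 5-space that are not I-points, out of `(q² + q + 1)(q³ +
1)`. -/
theorem ncard_isIIColonPoint_on_normKer (h : IsCoordinateFrobenius f b τ)
    (hL : Module.finrank K L = 3)
    (hφ : ∀ A : ℙ K V, φ (spreadPoint L A) = spreadPoint L (act τ A)) :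
    (Nat.card K ^ 2 + Nat.card K + 1) * (Nat.card K + 1) +
      {A : ℙ K V | On A (normKer τ) ∧ IsIIColonPoint φ τ A}.ncard =
      (Nat.card K ^ 2 + Nat.card K + 1) * (Nat.card K ^ 3 + 1) := by
  have h6 := ncard_setOf_on _ (h.finrank_normKer hL)
  have h1 := ncard_on_diff (fun _ => True) (IsIPoint φ) (normKer τ) fun A _ _ => trivial
  rw [h.ncard_isIPoint_on_normKer hL hφ] at h1
  simp only [and_true, true_and, h6] at h1
  rw [show (Nat.card K ^ 2 + Nat.card K + 1) * (Nat.card K ^ 3 + 1) =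
    ∑ i ∈ Finset.range 6, Nat.card K ^ i by
      simp only [Finset.sum_range_succ, Finset.sum_range_zero]; ring, ← h1]
  congr 2
  ext A
  exact and_congr_right fun hA => h.isIIColonPoint_iff hL hφ hA

end IsCoordinateFrobenius

end BoseRep

namespace BoseRep

/-! ### Fixed-I-lines and fixed-II-lines -/

namespace IsCoordinateFrobenius

variable {K L V : Type*} [Field K] [Field L] [Algebra K L] [AddCommGroup V]
  [Module K V] [Module L V] [IsScalarTower K L V] [Finite K] [Finite V]
  {f : L ≃ₐ[K] L} {b : Module.Basis (Fin 3) L V} {τ : V ≃ₗ[K] V} {φ : Equiv.Perm (ℙ L V)}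

theorem isFixedSubspace_of_invariant {l : Submodule K V} (hinv : ∀ v ∈ l, τ v ∈ l) :
    IsFixedSubspace τ l := by
  refine Submodule.eq_of_le_of_finrank_eq ?_ (LinearEquiv.finrank_map_eq τ l)
  rintro _ ⟨v, hv, rfl⟩
  exact hinv v hv

theorem apply_mem_of_isFixedSubspace {l : Submodule K V} (hl : IsFixedSubspace τ l) {v : V}
    (hv : v ∈ l) : τ v ∈ l := by
  have : τ v ∈ l.map (τ : V →ₗ[K] V) := ⟨v, hv, rfl⟩
  rwa [hl] at this

theorem act_on {l : Submodule K V} (hinv : ∀ v ∈ l, τ v ∈ l) {A : ℙ K V} (hA : On A l) :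
    On (act τ A) l := by
  induction A using Projectivization.ind with
  | h v hv => exact on_mk.2 (hinv v (on_mk.1 hA))

/-- On an invariant line that is not fixed pointwise, the moved points number
`q + 1` minus the number of fixed points. -/
theorem ncard_moved_on_line {l : Submodule K V} (hl : l ≤ normKer τ)
    (h2 : Module.finrank K l = 2) (hinv : ∀ v ∈ l, τ v ∈ l) (hns : ¬ IsPtwiseFixed τ l) :
    (omegaRoots K).ncard + {A : ℙ K V | On A l ∧ act τ A ≠ A}.ncard = Nat.card K + 1 := by
  have h1 := ncard_on_diff (fun _ => True) (fun A => act τ A = A) l fun A _ _ => trivial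
  have h3 := ncard_setOf_on l h2
  rw [ncard_fixed_on_line hl h2 hinv hns] at h1
  simp only [and_true, true_and, h3] at h1
  rw [h1]
  simp [Finset.sum_range_succ, add_comm]

/-! ### Lines in spread elements of Type I -/

theorem isFixedILine_iff (h : IsCoordinateFrobenius f b τ) (hL : Module.finrank K L = 3)
    (hφ : ∀ A : ℙ K V, φ (spreadPoint L A) = spreadPoint L (act τ A)) {n : ℤ}
    (hn : ((omegaRoots K).ncard : ℤ) = n + 1) {l : Submodule K V} :
    (l ≤ normKer τ ∧ IsFixedILine φ τ n l) ↔ ∃ P, IsTypeI φ P ∧ sPlane K P ⊓ normKer τ = l := by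
  constructor
  · rintro ⟨hl, h2, -, -, -, P, hP, hlP⟩
    refine ⟨P, hP, (Submodule.eq_of_le_of_finrank_eq (le_inf hlP hl) ?_).symm⟩
    exact Eq.trans h2 (h.finrank_sPlane_inf hL hφ hP).symm
  · rintro ⟨P, hP, rfl⟩
    have h2 := h.finrank_sPlane_inf hL hφ hP
    have hinv : ∀ v ∈ sPlane K P ⊓ normKer τ, τ v ∈ sPlane K P ⊓ normKer τ := fun v hv =>
      ⟨apply_mem_sPlane hφ hP hv.1, h.apply_mem_normKer hL hv.2⟩
    have hns := h.not_isPtwiseFixed_sPlane_inf hL hφ hP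
    refine ⟨inf_le_right, h2, isFixedSubspace_of_invariant hinv, ?_, ?_, P, hP, inf_le_left⟩
    · rw [ncard_fixed_on_line inf_le_right h2 hinv hns, hn]
    · have h3 := ncard_moved_on_line inf_le_right h2 hinv hns
      have h4 : {A : ℙ K V | On A (sPlane K P ⊓ normKer τ) ∧ IsIColonPoint φ τ A} =
          {A : ℙ K V | On A (sPlane K P ⊓ normKer τ) ∧ act τ A ≠ A} := by
        ext A
        refine and_congr_right fun hA => ?_
        rw [h.isIColonPoint_iff hL (hA.mono inf_le_right)]
        exact and_iff_right ⟨P, hP, hA.mono inf_le_left⟩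
      rw [h4]
      omega

theorem ncard_isFixedILine (h : IsCoordinateFrobenius f b τ) (hL : Module.finrank K L = 3)
    (hφ : ∀ A : ℙ K V, φ (spreadPoint L A) = spreadPoint L (act τ A)) {n : ℤ}
    (hn : ((omegaRoots K).ncard : ℤ) = n + 1) :
    {l : Submodule K V | l ≤ normKer τ ∧ IsFixedILine φ τ n l}.ncard =
      Nat.card K ^ 2 + Nat.card K + 1 := by
  have : {l : Submodule K V | l ≤ normKer τ ∧ IsFixedILine φ τ n l} =
      (fun P : ℙ L V => sPlane K P ⊓ normKer τ) '' {P | IsTypeI φ P} := by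
    ext l
    exact h.isFixedILine_iff hL hφ hn
  rw [this, ← h.ncard_isTypeI hL hφ]
  refine Set.InjOn.ncard_image fun P hP Q _ heq => ?_
  have h2 := h.finrank_sPlane_inf hL hφ hP
  obtain ⟨v, hv, h0⟩ := (sPlane K P ⊓ normKer τ).exists_mem_ne_zero_of_ne_bot (by
    intro h0
    rw [h0, finrank_bot] at h2
    omega)
  have hv' : v ∈ sPlane K Q ⊓ normKer τ := heq ▸ hv
  rw [← on_sPlane_iff.1 (on_mk.2 hv.1 : On (Projectivization.mk K v h0) _),
    on_sPlane_iff.1 (on_mk.2 hv'.1 : On (Projectivization.mk K v h0) _)]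

/-! ### Lines through II-points -/

section IILine

variable {l : Submodule K V} {A : ℙ K V}

theorem not_isPtwiseFixed_of_not_isIPoint
    (hφ : ∀ A : ℙ K V, φ (spreadPoint L A) = spreadPoint L (act τ A))
    (hA : On A l) (hA1 : ¬ IsIPoint φ A) : ¬ IsPtwiseFixed τ l :=
  fun hfix => hA1 (isIPoint_of_fixed hφ (hfix A hA))

/-- If a I-point `B` of `l` moved, `B` and its image would lie in the same Type I spread element,
which would contain `l` and with it `A`. -/
theorem isIPoint_iff_fixed_on_line
    (hφ : ∀ A : ℙ K V, φ (spreadPoint L A) = spreadPoint L (act τ A))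
    (h2 : Module.finrank K l = 2) (hinv : ∀ v ∈ l, τ v ∈ l)
    (hA : On A l) (hA1 : ¬ IsIPoint φ A) {B : ℙ K V} (hB : On B l) :
    IsIPoint φ B ↔ act τ B = B := by
  refine ⟨fun hI => ?_, isIPoint_of_fixed hφ⟩
  by_contra hne
  have hI' := isIPoint_iff.1 hI
  have hBQ : On B (sPlane K (spreadPoint L B)) := on_sPlane_iff.2 rfl
  have hle : l ≤ sPlane K (spreadPoint L B) :=
    eq_of_on_of_on h2 (Ne.symm hne) hB (act_on hinv hB) hBQ
      (act_on (fun v hv => apply_mem_sPlane hφ hI' hv) hBQ)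
  exact hA1 ⟨_, hI', hA.mono hle⟩

/-- Two points of `l` in one spread element would put `l` inside it; that element would contain `A`
and its image, hence be of Type I. -/
theorem spreadPoint_injOn_line
    (hφ : ∀ A : ℙ K V, φ (spreadPoint L A) = spreadPoint L (act τ A))
    (h2 : Module.finrank K l = 2) (hinv : ∀ v ∈ l, τ v ∈ l)
    (hA : On A l) (hA1 : ¬ IsIPoint φ A) :
    Set.InjOn (spreadPoint L) {B : ℙ K V | On B l} := by
  intro B hB C hC hBC
  by_contra hne
  have hle : l ≤ sPlane K (spreadPoint L B) :=
    eq_of_on_of_on h2 hne hB hC (on_sPlane_iff.2 rfl) (on_sPlane_iff.2 hBC.symm)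
  have h1 := on_sPlane_iff.1 (hA.mono hle)
  have h3 := on_sPlane_iff.1 ((act_on hinv hA).mono hle)
  refine hA1 (isIPoint_iff.2 ?_)
  rw [IsTypeI, hφ, h3, h1]

/-- The line is the `L`-span of `v` and `τ v`, of rank 2 because the spread element of `v` is moved,
and invariant because `τ² v = -v - τ v`. -/
theorem existsUnique_hSpace (h : IsCoordinateFrobenius f b τ) (hL : Module.finrank K L = 3)
    (hφ : ∀ A : ℙ K V, φ (spreadPoint L A) = spreadPoint L (act τ A))
    {v : V} (hv : v ≠ 0) (hN : v ∈ normKer τ)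
    (hv1 : ¬ IsIPoint φ (Projectivization.mk K v hv)) :
    ∃ m : Submodule L V, IsTypeILine φ m ∧ Submodule.span K {v, τ v} ≤ hSpace K m ∧
      ∀ m' : Submodule L V, IsSubspaceOfDim 1 m' → Submodule.span K {v, τ v} ≤ hSpace K m' →
        m' = m := by
  have hne : ∀ a : L, a • v ≠ τ v := by
    intro a ha
    refine hv1 (isIPoint_iff.2 ?_)
    rw [IsTypeI, hφ, act_mk, spreadPoint_mk, spreadPoint_mk]
    exact (Projectivization.mk_eq_mk_iff' L _ _ _ _).2 ⟨a, ha⟩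
  have hvm : v ∈ Submodule.span L {v, τ v} := Submodule.subset_span (by simp)
  have hτm : τ v ∈ Submodule.span L {v, τ v} := Submodule.subset_span (by simp)
  have hττ : τ (τ v) = -v - τ v := by
    rw [← sub_eq_zero, ← mem_normKer.1 hN]
    abel
  have hinv : ∀ w ∈ Submodule.span L {v, τ v}, τ w ∈ Submodule.span L {v, τ v} := by
    intro w hw
    obtain ⟨x, y, rfl⟩ := Submodule.mem_span_pair.1 hw
    rw [map_add, h.map_smul, h.map_smul, hττ]
    exact Submodule.add_mem _ (Submodule.smul_mem _ _ hτm)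
      (Submodule.smul_mem _ _ (Submodule.sub_mem _ (Submodule.neg_mem _ hvm) hτm))
  have hφm : ∀ P : ℙ L V, On P (Submodule.span L {v, τ v}) →
      On (φ P) (Submodule.span L {v, τ v}) := by
    intro P hP
    induction P using Projectivization.ind with
    | h w hw =>
    rw [← spreadPoint_mk (K := K), hφ, act_mk, spreadPoint_mk]
    exact on_mk.2 (hinv w (on_mk.1 hP))
  refine ⟨Submodule.span L {v, τ v}, ⟨finrank_span_pair_eq_two hv hne, fun P => ⟨hφm P, ?_⟩⟩,
    ?_, ?_⟩
  · intro hP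
    -- The converse implication uses `φ⁻¹ = φ²`.
    rw [← h.perm_three hL hφ P]
    exact hφm _ (hφm _ hP)
  · rw [Submodule.span_le]
    rintro x (rfl | rfl)
    exacts [hvm, hτm]
  · intro m' hm' hle
    exact (eq_span_pair hm' hv hne (hle (Submodule.subset_span (by simp)))
      (hle (Submodule.subset_span (by simp)))).symm

theorem isFixedIILine_span (h : IsCoordinateFrobenius f b τ) (hL : Module.finrank K L = 3)
    (hφ : ∀ A : ℙ K V, φ (spreadPoint L A) = spreadPoint L (act τ A)) {n : ℤ}
    (hn : ((omegaRoots K).ncard : ℤ) = n + 1)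
    {v : V} (hv : v ≠ 0) (hN : v ∈ normKer τ)
    (hv1 : ¬ IsIPoint φ (Projectivization.mk K v hv)) :
    Submodule.span K {v, τ v} ≤ normKer τ ∧ IsFixedIILine φ τ n (Submodule.span K {v, τ v}) := by
  have hne : ∀ a : K, a • v ≠ τ v := by
    intro a ha
    exact hv1 (isIPoint_of_fixed hφ ((act_mk_eq_self_iff τ hv).2 ⟨a, ha.symm⟩))
  obtain ⟨m, hm⟩ := h.existsUnique_hSpace hL hφ hv hN hv1
  have hvl : v ∈ Submodule.span K {v, τ v} := Submodule.subset_span (by simp)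
  have hτl : τ v ∈ Submodule.span K {v, τ v} := Submodule.subset_span (by simp)
  have h2 := finrank_span_pair_eq_two hv hne
  have hττ : τ (τ v) = -v - τ v := by
    rw [← sub_eq_zero, ← mem_normKer.1 hN]
    abel
  have hl : Submodule.span K {v, τ v} ≤ normKer τ := by
    rw [Submodule.span_le]
    rintro x (rfl | rfl)
    exacts [hN, h.apply_mem_normKer hL hN]
  have hinv : ∀ w ∈ Submodule.span K {v, τ v}, τ w ∈ Submodule.span K {v, τ v} := by
    intro w hw
    obtain ⟨x, y, rfl⟩ := Submodule.mem_span_pair.1 hw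
    rw [map_add, _root_.map_smul, _root_.map_smul, hττ]
    exact Submodule.add_mem _ (Submodule.smul_mem _ _ hτl)
      (Submodule.smul_mem _ _ (Submodule.sub_mem _ (Submodule.neg_mem _ hvl) hτl))
  generalize Submodule.span K {v, τ v} = l at *
  have hA : On (Projectivization.mk K v hv) l := on_mk.2 hvl
  have hns := not_isPtwiseFixed_of_not_isIPoint hφ hA hv1
  have hfix := ncard_fixed_on_line hl h2 hinv hns
  have hmov := ncard_moved_on_line hl h2 hinv hns
  have hI : ∀ {B : ℙ K V}, On B l → (IsIPoint φ B ↔ act τ B = B) := fun hB =>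
    isIPoint_iff_fixed_on_line hφ h2 hinv hA hv1 hB
  have hinj := spreadPoint_injOn_line hφ h2 hinv hA hv1
  refine ⟨hl, h2, isFixedSubspace_of_invariant hinv, ?_, ?_, ?_, ?_, m, hm⟩
  · rw [hfix, hn]
  · have h4 : {B : ℙ K V | On B l ∧ IsIIColonPoint φ τ B} =
        {B : ℙ K V | On B l ∧ act τ B ≠ B} := by
      ext B
      refine and_congr_right fun hB => ?_
      rw [h.isIIColonPoint_iff hL hφ (hB.mono hl), hI hB]
    rw [h4]
    omega
  · have h4 : {P : ℙ L V | IsTypeI φ P ∧ ¬ Disjoint l (sPlane K P)} =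
        spreadPoint L '' {B : ℙ K V | On B l ∧ act τ B = B} := by
      ext P
      simp only [Set.mem_ofPred_eq, Set.mem_image, not_disjoint_sPlane_iff]
      constructor
      · rintro ⟨hP, B, hB, rfl⟩
        exact ⟨B, ⟨hB, (hI hB).1 (isIPoint_iff.2 hP)⟩, rfl⟩
      · rintro ⟨B, ⟨hB, hfB⟩, rfl⟩
        exact ⟨isIPoint_iff.1 ((hI hB).2 hfB), B, hB, rfl⟩
    rw [h4, Set.InjOn.ncard_image (hinj.mono fun B hB => hB.1), hfix, hn]
  · have h4 : {P : ℙ L V | IsTypeII φ P ∧ ¬ Disjoint l (sPlane K P)} =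
        spreadPoint L '' {B : ℙ K V | On B l ∧ act τ B ≠ B} := by
      ext P
      simp only [Set.mem_ofPred_eq, Set.mem_image, not_disjoint_sPlane_iff]
      constructor
      · rintro ⟨hP, B, hB, rfl⟩
        exact ⟨B, ⟨hB, fun hfB => (h.isIIPoint_iff_not_isIPoint hL hφ (hB.mono hl)).1
          (isIIPoint_iff.2 hP) ((hI hB).2 hfB)⟩, rfl⟩
      · rintro ⟨B, ⟨hB, hfB⟩, rfl⟩
        exact ⟨isIIPoint_iff.1 ((h.isIIPoint_iff_not_isIPoint hL hφ (hB.mono hl)).2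
          fun hIB => hfB ((hI hB).1 hIB)), B, hB, rfl⟩
    rw [h4, Set.InjOn.ncard_image (hinj.mono fun B hB => hB.1)]
    omega

end IILine

/-- Every II-point of the kernel of the norm map lies on exactly one fixed-II-line. -/
theorem ncard_isFixedIILine (h : IsCoordinateFrobenius f b τ) (hL : Module.finrank K L = 3)
    (hφ : ∀ A : ℙ K V, φ (spreadPoint L A) = spreadPoint L (act τ A)) {n : ℤ}
    (hn : ((omegaRoots K).ncard : ℤ) = n + 1) :
    ({A : ℙ K V | On A (normKer τ) ∧ IsIIColonPoint φ τ A}.ncard : ℤ) =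
      {l : Submodule K V | l ≤ normKer τ ∧ IsFixedIILine φ τ n l}.ncard * (Nat.card K - n) := by
  by_cases hemp : {l : Submodule K V | l ≤ normKer τ ∧ IsFixedIILine φ τ n l} = ∅
  · have : {A : ℙ K V | On A (normKer τ) ∧ IsIIColonPoint φ τ A} = ∅ := by
      rw [Set.eq_empty_iff_forall_notMem]
      rintro A ⟨hA, hA2⟩
      rw [h.isIIColonPoint_iff hL hφ hA] at hA2
      induction A using Projectivization.ind with
      | h v hv =>
      exact Set.eq_empty_iff_forall_notMem.1 hemp _
        (h.isFixedIILine_span hL hφ hn hv (on_mk.1 hA) hA2)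
    simp [this, hemp]
  -- A member line shows `q - n ≥ 0`, since this is its number of `II:`-points; hence the separate
  -- treatment of the empty case.
  obtain ⟨l₀, hl₀⟩ := Set.nonempty_iff_ne_empty.2 hemp
  have hpos : (((Nat.card K : ℤ) - n).toNat : ℤ) = Nat.card K - n :=
    Int.toNat_of_nonneg (hl₀.2.2.2.2.1 ▸ Int.natCast_nonneg _)
  rw [← hpos, ← Nat.cast_mul, ← ncard_biUnion_eq_mul (Set.toFinite _)
    (s := fun l => {A : ℙ K V | On A l ∧ IsIIColonPoint φ τ A}) (fun _ _ => Set.toFinite _)]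
  · congr 2
    ext A
    simp only [Set.mem_iUnion, Set.mem_ofPred_eq, exists_prop]
    constructor
    · rintro ⟨hA, hA2⟩
      have hA3 := hA2
      rw [h.isIIColonPoint_iff hL hφ hA] at hA3
      induction A using Projectivization.ind with
      | h v hv =>
      exact ⟨_, h.isFixedIILine_span hL hφ hn hv (on_mk.1 hA) hA3,
        on_mk.2 (Submodule.subset_span (by simp)), hA2⟩
    · rintro ⟨l, ⟨hl, -⟩, hA, hA2⟩
      exact ⟨hA.mono hl, hA2⟩
  · rintro l ⟨-, hl⟩
    have := hl.2.2.2.1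
    omega
  · rintro l ⟨hl, hl2, hlf, -⟩ l' ⟨-, hl2', hlf', -⟩ hne
    refine Set.disjoint_left.2 fun A hA hA' => hne ?_
    obtain ⟨hAl, hA2⟩ := hA
    obtain ⟨hAl', -⟩ := hA'
    rw [h.isIIColonPoint_iff hL hφ (hAl.mono hl)] at hA2
    induction A using Projectivization.ind with
    | h v hv =>
    -- A fixed line through the moved point of `v` must be the span of `v` and `τ v`.
    have hne : ∀ a : K, a • v ≠ τ v := fun a ha =>
      hA2 (isIPoint_of_fixed hφ ((act_mk_eq_self_iff τ hv).2 ⟨a, ha.symm⟩))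
    rw [on_mk] at hAl hAl'
    rw [← eq_span_pair hl2 hv hne hAl (apply_mem_of_isFixedSubspace hlf hAl),
      ← eq_span_pair hl2' hv hne hAl' (apply_mem_of_isFixedSubspace hlf' hAl')]

end IsCoordinateFrobenius

end BoseRep

namespace BoseRep

/-! ### Reduction of `σ` to the normal form `τ` -/

section Reduction

variable {K L V : Type*} [Field K] [Field L] [Algebra K L] [AddCommGroup V]
  [Module K V] [Module L V] [IsScalarTower K L V]
  {σ : V ≃ₗ[K] V} {φ : Equiv.Perm (ℙ L V)}

theorem Induces.apply_mk (hσ : Induces σ φ) {v : V} (hv : v ≠ 0) :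
    φ (Projectivization.mk L v hv) =
      Projectivization.mk L (σ v) (σ.map_ne_zero_iff.2 hv) := by
  have hmem : σ v ∈ sPlane K (φ (Projectivization.mk L v hv)) := by
    rw [← hσ]
    exact ⟨v, on_mk.1 (on_sPlane_iff.2 (spreadPoint_mk (K := K) hv)), rfl⟩
  have := on_sPlane_iff.1 (on_mk.2 hmem : On (Projectivization.mk K (σ v)
    (σ.map_ne_zero_iff.2 hv)) _)
  rw [← this, spreadPoint_mk]

theorem Induces.exists_smul (hσ : Induces σ φ) (x : L) (v : V) : ∃ y : L, σ (x • v) = y • σ v := by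
  by_cases hv : v = 0
  · exact ⟨0, by simp [hv]⟩
  by_cases hx : x = 0
  · exact ⟨0, by simp [hx]⟩
  have h1 : Projectivization.mk L (x • v) (smul_ne_zero hx hv) = Projectivization.mk L v hv :=
    (Projectivization.mk_eq_mk_iff' L _ _ _ _).2 ⟨x, rfl⟩
  have h2 := congrArg φ h1
  rw [hσ.apply_mk, hσ.apply_mk, Projectivization.mk_eq_mk_iff'] at h2
  obtain ⟨y, hy⟩ := h2
  exact ⟨y, hy.symm⟩

/-- A `K`-linear map that permutes the spread and fixes the `K`-rational points with respect to
`b` is the composition of a field automorphism and a homothety. -/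
theorem Induces.exists_algEquiv [FiniteDimensional K L] (hσ : Induces σ φ)
    (b : Module.Basis (Fin 3) L V)
    (hb : ∀ (a : Fin 3 → K) (h : (∑ i, a i • b i) ≠ 0),
      φ (Projectivization.mk L (∑ i, a i • b i) h) = Projectivization.mk L (∑ i, a i • b i) h) :
    ∃ (f : L ≃ₐ[K] L) (c : L), c ≠ 0 ∧ ∀ v i, b.repr (σ v) i = c * f (b.repr v i) := by
  have hfix : ∀ a : Fin 3 → K, ∃ y : L, σ (∑ i, a i • b i) = y • ∑ i, a i • b i := by
    intro a
    by_cases h : (∑ i, a i • b i) = 0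
    · exact ⟨0, by simp [h]⟩
    · have := hb a h
      rw [hσ.apply_mk, Projectivization.mk_eq_mk_iff'] at this
      obtain ⟨y, hy⟩ := this
      exact ⟨y, hy.symm⟩
  -- The unit point `b 0 + b 1 + b 2` is fixed too, which forces the multipliers of the three basis
  -- vectors to agree.
  obtain ⟨c, hc⟩ := hfix 1
  simp only [Pi.one_apply, one_smul] at hc
  have hbi : ∀ i, ∃ y : L, σ (b i) = y • b i := by
    intro i
    obtain ⟨y, hy⟩ := hfix (Pi.single i 1)
    refine ⟨y, ?_⟩
    simpa [Pi.single_apply, ite_smul] using hy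
  choose d hd using hbi
  have hdc : ∀ i, d i = c := by
    intro i
    have := congrArg (fun v => b.repr v i) hc
    simp only [map_sum, hd] at this
    simpa [Finsupp.single_apply] using this
  have hσb : ∀ i, σ (b i) = c • b i := fun i => by rw [hd, hdc]
  have hc0 : c ≠ 0 := by
    rintro rfl
    have := hσb 0
    rw [zero_smul, LinearEquiv.map_eq_zero_iff] at this
    exact b.ne_zero 0 this
  let T : L →ₗ[K] L :=
    (b.coord 0).restrictScalars K ∘ₗ (σ : V →ₗ[K] V) ∘ₗ
      (LinearMap.toSpanSingleton L V (b 0)).restrictScalars K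
  have hT0 : ∀ x, T x = b.repr (σ (x • b 0)) 0 := fun _ => rfl
  have hT : ∀ x i, σ (x • b i) = T x • b i := by
    intro x i
    have hx : ∀ i, ∃ y : L, σ (x • b i) = y • b i := by
      intro i
      obtain ⟨y, hy⟩ := hσ.exists_smul x (b i)
      exact ⟨y * c, by rw [hy, hσb, smul_smul]⟩
    choose y hy using hx
    -- The unit point again: the same function `T` must describe `σ` on each of the three coordinate
    -- axes.
    obtain ⟨z, hz⟩ := hσ.exists_smul x (∑ i, b i)
    rw [hc, Finset.smul_sum, map_sum, smul_smul] at hz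
    have hyi : ∀ i, y i = z * c := by
      intro i
      have := congrArg (fun v => b.repr v i) hz
      simp only [hy] at this
      simpa [Finsupp.single_apply] using this
    rw [hT0, hy, hy, hyi, hyi]
    simp
  have hT1 : T 1 = c := by
    have := congrArg (fun v => b.repr v 0) (hT 1 0)
    simp only [one_smul, hσb] at this
    simpa using this.symm
  have hmul : ∀ x y, c * T (x * y) = T x * T y := by
    intro x y
    -- Comparing coordinates for `x (b 0 + y b 1)` gives `T x = z c` and `T (x y) = z T y`, so `c⁻¹
    -- T` is multiplicative.
    obtain ⟨z, hz⟩ := hσ.exists_smul x (b 0 + y • b 1)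
    rw [smul_add, smul_smul, map_add, map_add, hT, hT, hT, hσb] at hz
    have h0 := congrArg (fun v => b.repr v 0) hz
    have h1 := congrArg (fun v => b.repr v 1) hz
    simp at h0 h1
    rw [h0, h1]
    ring
  let F : L →ₐ[K] L := AlgHom.ofLinearMap (LinearMap.mulLeft K c⁻¹ ∘ₗ T)
    (by simp [hT1, hc0]) (fun x y => by
      have := hmul x y
      simp only [LinearMap.comp_apply, LinearMap.mulLeft_apply]
      field_simp
      linear_combination this)
  have hF : ∀ x, F x = c⁻¹ * T x := fun _ => rfl
  refine ⟨AlgEquiv.ofBijective F (Algebra.IsAlgebraic.algHom_bijective F), c, hc0, fun v i => ?_⟩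
  rw [AlgEquiv.ofBijective_apply, hF, mul_inv_cancel_left₀ hc0]
  have : σ v = ∑ i, T (b.repr v i) • b i := by
    conv_lhs => rw [← b.sum_repr v, map_sum]
    exact Finset.sum_congr rfl fun i _ => hT _ _
  rw [this, b.repr_sum_self]

/-- If every hyperplane through `U` is fixed, then `σ` acts on the quotient by `U` as a scalar. -/
theorem exists_scalar_of_hyperplanes_fixed {U : Submodule K V} (hV : Module.finrank K V = 9)
    (hH : ∀ H : Submodule K V, IsSubspaceOfDim 7 H → U ≤ H → IsFixedSubspace σ H) :
    ∃ c : K, ∀ v, σ v - c • v ∈ U := by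
  have : FiniteDimensional K V := Module.finite_of_finrank_pos (by omega)
  -- Dually, hyperplanes through `U` are kernels of functionals vanishing on `U`, and a fixed kernel
  -- makes its functional an eigenvector of the transpose. All being eigenvectors, they share one
  -- eigenvalue.
  have h1 : ∀ ℓ ∈ U.dualAnnihilator, ∃ μ : K, (σ : V →ₗ[K] V).dualMap ℓ = μ • ℓ := by
    intro ℓ hℓ
    by_cases h0 : ℓ = 0
    · exact ⟨0, by simp [h0]⟩
    have hfix := hH (LinearMap.ker ℓ) (by
      have := Module.Dual.finrank_ker_add_one_of_ne_zero h0
      rw [IsSubspaceOfDim]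
      omega) (fun v hv => (Submodule.mem_dualAnnihilator ℓ).1 hℓ v hv)
    obtain ⟨w, hw⟩ : ∃ w, ℓ w ≠ 0 := by
      by_contra! hall
      exact h0 (LinearMap.ext hall)
    refine ⟨ℓ (σ w) / ℓ w, LinearMap.ext fun v => ?_⟩
    have hk : v - (ℓ v / ℓ w) • w ∈ LinearMap.ker ℓ := by
      rw [LinearMap.mem_ker, map_sub, map_smul, smul_eq_mul, div_mul_cancel₀ _ hw, sub_self]
    have hk' : σ (v - (ℓ v / ℓ w) • w) ∈ LinearMap.ker ℓ := by
      have : σ (v - (ℓ v / ℓ w) • w) ∈ (LinearMap.ker ℓ).map (σ : V →ₗ[K] V) := ⟨_, hk, rfl⟩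
      rwa [hfix] at this
    rw [LinearMap.mem_ker, map_sub, map_smul, map_sub, map_smul, sub_eq_zero] at hk'
    rw [LinearMap.dualMap_apply, LinearEquiv.coe_coe, hk', LinearMap.smul_apply, smul_eq_mul,
      smul_eq_mul]
    ring
  obtain ⟨c, hc⟩ := exists_scalar_of_forall_exists (σ : V →ₗ[K] V).dualMap U.dualAnnihilator h1
  refine ⟨c, fun v => ?_⟩
  rw [← Subspace.forall_mem_dualAnnihilator_apply_eq_zero_iff]
  intro ℓ hℓ
  have := LinearMap.congr_fun (hc ℓ hℓ) v
  rw [map_sub, map_smul, sub_eq_zero]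
  exact this

/-- Up to a scalar, `σ` applies a nontrivial field automorphism to the coordinates with respect to
a suitable basis, and `U` is the kernel of the corresponding norm map. -/
theorem exists_isCoordinateFrobenius [Finite K] (hL : Module.finrank K L = 3)
    (hφ1 : φ ≠ 1) (hφB : ∃ B : Set (ℙ L V), IsSubplane K B ∧ ∀ P ∈ B, φ P = P)
    (hσ : Induces σ φ) {U : Submodule K V} (hU : IsHwiseFixed5Space σ U) :
    ∃ (f : L ≃ₐ[K] L) (b : Module.Basis (Fin 3) L V) (τ : V ≃ₗ[K] V) (c : K),
      IsCoordinateFrobenius f b τ ∧ c ≠ 0 ∧ (∀ v, σ v = c • τ v) ∧ U = normKer τ := by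
  have : FiniteDimensional K L := Module.finite_of_finrank_pos (by omega)
  obtain ⟨_, ⟨b, rfl⟩, hB⟩ := hφB
  obtain ⟨f, d, hd0, hf⟩ := hσ.exists_algEquiv b fun a h => hB _ ⟨a, h, rfl⟩
  have hV : Module.finrank K V = 9 := IsCoordinateFrobenius.finrank_eq_nine b hL
  have : FiniteDimensional K V := Module.finite_of_finrank_pos (by omega)
  have hsmul : ∀ (x : L) (v : V), σ (x • v) = f x • σ v := by
    intro x v
    refine b.ext_elem fun i => ?_
    rw [hf, map_smul, map_smul, Finsupp.smul_apply, Finsupp.smul_apply, hf, smul_eq_mul,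
      smul_eq_mul, map_mul]
    ring
  have hf1 : f ≠ 1 := by
    rintro rfl
    refine hφ1 (Equiv.ext fun P => ?_)
    induction P using Projectivization.ind with
    | h v hv =>
    rw [hσ.apply_mk, Equiv.Perm.one_apply, Projectivization.mk_eq_mk_iff']
    refine ⟨d, b.ext_elem fun i => ?_⟩
    rw [hf, map_smul, Finsupp.smul_apply, smul_eq_mul, AlgEquiv.one_apply]
  obtain ⟨c, hc⟩ := exists_scalar_of_hyperplanes_fixed hV hU.2
  -- The map `σ - c` sends a space of rank 9 into `U`, of rank 6, so its kernel is nonzero.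
  obtain ⟨v, hv, hv0⟩ : ∃ v ∈ eigen σ c, v ≠ 0 := by
    refine (eigen σ c).exists_mem_ne_zero_of_ne_bot fun h0 => ?_
    have h9 := LinearMap.finrank_range_add_finrank_ker ((σ : V →ₗ[K] V) - c • LinearMap.id)
    rw [← eigen, h0, finrank_bot, hV] at h9
    have hle : LinearMap.range ((σ : V →ₗ[K] V) - c • LinearMap.id) ≤ U := by
      rintro _ ⟨v, rfl⟩
      simpa using hc v
    have := Submodule.finrank_mono hle
    have h6 : Module.finrank K U = 6 := hU.1
    omega
  rw [mem_eigen] at hv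
  have hc0 : c ≠ 0 := by
    rintro rfl
    rw [zero_smul, LinearEquiv.map_eq_zero_iff] at hv
    exact hv0 hv
  obtain ⟨i, hi⟩ : ∃ i, b.repr v i ≠ 0 := by
    by_contra! h0
    exact hv0 (b.ext_elem fun i => by simp [h0])
  have hd : d * f (b.repr v i) = c • b.repr v i := by
    rw [← hf, hv, ← algebraMap_smul L c v, map_smul, Finsupp.smul_apply, algebraMap_smul]
  have hσb : ∀ j, σ (b j) = d • b j := by
    intro j
    refine b.ext_elem fun k => ?_
    rw [hf, map_smul, Finsupp.smul_apply, smul_eq_mul]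
    by_cases hjk : j = k <;> simp [hjk]
  let τ : V ≃ₗ[K] V := σ.trans (LinearEquiv.smulOfNeZero K V c⁻¹ (inv_ne_zero hc0))
  have hτ : ∀ v, τ v = c⁻¹ • σ v := fun _ => rfl
  -- With `x` this coordinate, `d f(x) = c x`; hence `σ (x b j) = c x b j`, and `τ` fixes the
  -- rescaled basis.
  let b' := b.isUnitSMul (w := fun _ => b.repr v i) fun _ => hi.isUnit
  have hb' : ∀ j, b' j = b.repr v i • b j := fun j => b.isUnitSMul_apply _ j
  have hF : IsCoordinateFrobenius f b' τ := by
    refine ⟨hf1, fun x v => ?_, fun j => ?_⟩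
    · rw [hτ, hτ, hsmul, smul_comm]
    · rw [hτ, hb', hsmul, hσb, smul_smul, mul_comm, hd, smul_assoc, inv_smul_smul₀ hc0]
  refine ⟨f, b', τ, c, hF, hc0, fun v => ?_, hF.eq_normKer hL hU.1 fun v => ?_⟩
  · rw [hτ, smul_inv_smul₀ hc0]
  · have := U.smul_mem c⁻¹ (hc v)
    rwa [smul_sub, inv_smul_smul₀ hc0] at this

theorem act_eq_of_smul {τ : V ≃ₗ[K] V} {c : K} (h : ∀ v, σ v = c • τ v) : act σ = act τ := by
  funext A
  induction A using Projectivization.ind with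
  | h v hv =>
  rw [act_mk, act_mk, Projectivization.mk_eq_mk_iff']
  exact ⟨c, (h v).symm⟩

theorem isFixedSubspace_eq_of_smul {τ : V ≃ₗ[K] V} {c : K} (hc : c ≠ 0)
    (h : ∀ v, σ v = c • τ v) : IsFixedSubspace σ = IsFixedSubspace τ := by
  funext U
  have : (σ : V →ₗ[K] V) = c • (τ : V →ₗ[K] V) := LinearMap.ext h
  rw [IsFixedSubspace, IsFixedSubspace, this, Submodule.map_smul _ _ _ hc]

end Reduction

end BoseRep

/-! ### The counts for `σ` -/

open BoseRep in
theorem theorem7 {K L V : Type*} [Field K] [Finite K] [Field L] [Algebra K L]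
    [AddCommGroup V] [Module K V] [Module L V] [IsScalarTower K L V]
    (q g : ℕ) (n : ℤ)
    (hq : Nat.card K = q) (hq2 : 2 < q)
    (hn : n = -1 ∨ n = 0 ∨ n = 1) (hqn : (q : ℤ) ≡ n [ZMOD 3])
    (hg : g = Nat.gcd 3 (q - 1))
    (hL : Module.finrank K L = 3) (hV : Module.finrank L V = 3)
    (φ : Equiv.Perm (ℙ L V)) (hφ : IsCollineation φ) (hφ3 : orderOf φ = 3)
    (hφB : ∃ B : Set (ℙ L V), IsSubplane K B ∧ ∀ P ∈ B, φ P = P)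
    (σ : V ≃ₗ[K] V) (hσ : Induces σ φ)
    (U : Submodule K V) (hU : IsHwiseFixed5Space σ U) :
    -- points
    (({A : ℙ K V | On A U ∧ act σ A = A}.ncard : ℤ) = (n + 1) * (q ^ 2 + q + 1) ∧
      ({A : ℙ K V | On A U ∧ IsIColonPoint φ σ A}.ncard : ℤ) = (q - n) * (q ^ 2 + q + 1) ∧
      ({A : ℙ K V | On A U ∧ IsIIColonPoint φ σ A}.ncard : ℤ) =
        (q ^ 3 - q) * (q ^ 2 + q + 1)) ∧
    -- lines
    (({l : Submodule K V | l ≤ U ∧ IsPtwiseFixedLine σ l}.ncard : ℤ) =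
        (n + 1) * (q ^ 2 + q + 1) ∧
      {l : Submodule K V | l ≤ U ∧ IsFixedILine φ σ n l}.ncard = q ^ 2 + q + 1 ∧
      ({l : Submodule K V | l ≤ U ∧ IsFixedIILine φ σ n l}.ncard : ℚ) =
        ((q : ℚ) ^ 3 - q) * ((q : ℚ) ^ 2 + q + 1) / (q - n)) ∧
    -- planes
    (({π : Submodule K V | IsPtwiseFixedPlane σ π ∧ π ≤ U}.ncard : ℤ) = n + 1 ∧
      ({π : Submodule K V | IsPtwiseFixedPlane σ π ∧ ¬ π ≤ U}.ncard : ℤ) = g - (n + 1) ∧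
      ∀ π : Submodule K V, IsPtwiseFixedPlane σ π → ¬ π ≤ U → Disjoint π U) := by
  have hφ1 : φ ≠ 1 := by
    rintro rfl
    simp at hφ3
  obtain ⟨f, b, τ, c, h, hc0, hστ, rfl⟩ := exists_isCoordinateFrobenius hL hφ1 hφB hσ hU
  have h9 : Module.finrank K V = 9 := IsCoordinateFrobenius.finrank_eq_nine b hL
  have : FiniteDimensional K V := Module.finite_of_finrank_pos (by omega)
  have : Finite V := Module.finite_of_finite K
  have hact : act σ = act τ := act_eq_of_smul hστ
  have hφτ : ∀ A : ℙ K V, φ (spreadPoint L A) = spreadPoint L (act τ A) := by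
    intro A
    rw [← hact]
    induction A using Projectivization.ind with
    | h v hv => rw [spreadPoint_mk, hσ.apply_mk, act_mk, spreadPoint_mk]
  have hR : ((omegaRoots K).ncard : ℤ) = n + 1 := ncard_omegaRoots hn (hq ▸ hqn)
  have e1 : IsIColonPoint φ σ = IsIColonPoint φ τ := by
    funext A
    simp only [IsIColonPoint, hact]
  have e2 : IsIIColonPoint φ σ = IsIIColonPoint φ τ := by
    funext A
    simp only [IsIIColonPoint, hact]
  have e3 : IsPtwiseFixed σ = IsPtwiseFixed τ := by
    funext W
    simp only [IsPtwiseFixed, hact]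
  have e4 : IsPtwiseFixedLine σ = IsPtwiseFixedLine τ := by
    funext W
    simp only [IsPtwiseFixedLine, e3]
  have e5 : IsPtwiseFixedPlane σ = IsPtwiseFixedPlane τ := by
    funext W
    simp only [IsPtwiseFixedPlane, e3]
  have e6 := isFixedSubspace_eq_of_smul hc0 hστ
  have e7 : IsFixedILine φ σ n = IsFixedILine φ τ n := by
    funext W
    simp only [IsFixedILine, hact, e1, e6]
  have e8 : IsFixedIILine φ σ n = IsFixedIILine φ τ n := by
    funext W
    simp only [IsFixedIILine, hact, e2, e6]
  rw [hact, e1, e2, e4, e5, e7, e8]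
  have p1 := h.ncard_fixed_on_normKer hL
  have p2 := h.ncard_isIColonPoint_on_normKer hL hφτ
  have p3 := h.ncard_isIIColonPoint_on_normKer hL hφτ
  have l1 := h.ncard_ptwiseFixedLine hL
  have l2 := h.ncard_isFixedILine hL hφτ hR
  have l3 := h.ncard_isFixedIILine hL hφτ hR
  rw [hq] at p1 p2 p3 l1 l2 l3
  zify at p1 p2 p3 l1
  rw [hR] at p1 l1
  rw [p1] at p2
  have p3' : ({A : ℙ K V | On A (normKer τ) ∧ IsIIColonPoint φ τ A}.ncard : ℤ) =
      (q ^ 3 - q) * (q ^ 2 + q + 1) := by linear_combination p3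
  refine ⟨⟨p1, by linear_combination p2, p3'⟩, ⟨l1, l2, ?_⟩, ?_, ?_, ?_⟩
  · rw [p3'] at l3
    have hne : (q : ℚ) - n ≠ 0 := by
      -- Here `n ≤ 1 < q`.
      have : (q : ℤ) - n ≠ 0 := by omega
      exact_mod_cast this
    rw [eq_div_iff hne]
    exact_mod_cast l3.symm
  · rw [h.ncard_ptwiseFixedPlane_le hL, hR]
  · rw [h.ptwiseFixedPlane_not_le hL, one_mem_omegaRoots_iff, hq]
    rw [Int.ModEq] at hqn
    -- The extra plane is the fixed space of `τ`, present unless the characteristic is 3.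
    -- Correspondingly `g - (n + 1)` is 1 - 1, 1 - 0 and 3 - 2 for `n = 0`, `-1` and `1`.
    by_cases h3 : 3 ∣ q
    · have hn0 : n = 0 := by omega
      have hg1 : Nat.gcd 3 (q - 1) = 1 :=
        (Nat.Prime.coprime_iff_not_dvd Nat.prime_three).2 (by omega)
      simp [h3, hg, hg1, hn0]
    · have hs : {π : Submodule K V | π = eigen τ 1 ∧ ¬ 3 ∣ q} = {eigen τ 1} := by
        ext π
        simp [h3]
      rw [hs, Set.ncard_singleton, hg]
      rcases hn with rfl | rfl | rfl
      · have hg1 : Nat.gcd 3 (q - 1) = 1 :=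
          (Nat.Prime.coprime_iff_not_dvd Nat.prime_three).2 (by omega)
        simp [hg1]
      · omega
      · rw [Nat.gcd_eq_left (by omega)]
        norm_num
  · exact fun π hπ hle => h.disjoint_normKer hL hπ hle
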